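/- Fix an order $p\ge 0$, a period $T\ge 1$, hyper-parameters $\nu,a,b^{(1)},b^{(2)}>0$, an integer $M\ge 0$ and $d>0$. A relative changepoint model is $\lambda=(\lambda_1,\dots,\lambda_m)$ with $0<\lambda_1<\dots<\lambda_m<1$; put $\lambda_0=0$, $\lambda_{m+1}=1$, and let $\Lambda$ be the set of those with $m\le M$ and $\lambda_r-\lambda_{r-1}\ge d$ for $1\le r\le m+1$. For a sample size $N$ put $\tau_0=1$, $\tau_r=\lfloor\lambda_rN\rfloor$ $(1\le r\le m)$, $\tau_{m+1}=N+1$, $N_r=\lfloor\lambda_rN\rfloor-\lfloor\lambda_{r-1}N\rfloor$; time $t$ is in regime $r$ if $\tau_{r-1}\le t<\tau_r$, and in season $v(t)=t-T\lfloor (t-1)/T\rfloor$. Let $A$ be the $N\times T$ matrix of season indicators and $D$ the $N\times m$ matrix of indicators of the regimes $2,\dots,m+1$ of $\lambda$. For each $N$ a set of documented times in $\{p+1,\dots,N\}$ is given; $N^{(2)}$ and $N^{(1)}=N-p-N^{(2)}$ are the numbers of documented and undocumented times, $m^{(2)}$ and $m^{(1)}=m-m^{(2)}$ the numbers of documented and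 undocumented changepoints $\tau_1,\dots,\tau_m$ of $\lambda$. Assume that either there are no documented times for any $N$, or both $N^{(1)}$ and $N^{(2)}$ are of exact order $N$. Data. Let $X_t=s_{v(t)}+\mu_{r^0(t)}+\epsilon_t$, $1\le t\le N$, where $r^0(t)$ is the regime of $t$ under a true model $\lambda^0\in\Lambda$, the seasonal means $s_1,\dots,s_T$ and the regime means ($\mu_1=0$, the others arbitrary) are real numbers, and $\epsilon_t=\sum_{j=1}^p\phi_j\epsilon_{t-j}+Z_t$ $(t\in\mathbb Z)$ is a causal AR$(p)$ process, i.e. $\epsilon_t=\sum_{j\ge0}\psi_jZ_{t-j}$ with $\sum_j|\psi_j|<\infty$, driven by iid $Z_t$ with mean $0$ and variance $\sigma^2>0$ (for example normal). Estimators. Given $\lambda\in\Lambda$, let $\epsilon^{\rm ols}=(I-\mathcal P_{[A|D]})X$, where $\mathcal P$ denotes the orthogonal projection onto a column space, $\hat\gamma(h)=N^{-1}\sum_{t=h+1}^N\epsilon_t^{\rm ols}\epsilon_{t-h}^{\rm ols}$, and let $\hat\phi=\hat\Gamma_p^{-1}\hat\gamma_p$ be the Yule–Walker estimator, with $\hat\Gamma_p=(\hat\gamma(|i-j|))_{i,j=1}^p$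 and $\hat\gamma_p=(\hat\gamma(1),\dots,\hat\gamma(p))'$. Let $\hat X,\hat A,\hat D$ have the rows $X_t-\sum_j\hat\phi_jX_{t-j}$, $A_t-\sum_j\hat\phi_jA_{t-j}$, $D_t-\sum_j\hat\phi_jD_{t-j}$ for $t=p+1,\dots,N$, and put $\hat B=I-\hat D(\hat D'\hat D+I_m/\nu)^{-1}\hat D'$, $$\hat\sigma^2=\tfrac1{N-p}\hat X'\{\hat B-\hat B\hat A(\hat A'\hat B\hat A)^{-1}\hat A'\hat B\}\hat X,\qquad \hat\sigma^2_{\nu=\infty}=\tfrac1{N-p}\hat X'(I-\mathcal P_{[\hat A|\hat D]})\hat X .$$ Define $$\mathrm{BMDL}_N(\lambda)=\tfrac{N-p}2\log\hat\sigma^2+\tfrac m2\log\nu+\tfrac12\log\bigl|\hat D'\hat D+\tfrac{I_m}{\nu}\bigr|-\sum_{k=1}^2\log\bigl\{\Gamma(a+m^{(k)})\,\Gamma(b^{(k)}+N^{(k)}-m^{(k)})\bigr\},$$ $$\mathrm{MDL}_N(\lambda)=\tfrac{N-p}2\log\hat\sigma^2_{\nu=\infty}+\tfrac12\sum_{r=2}^{m+1}\log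 N_r+\log(m+1)+(m+1)\log(N-p).$$ Theorem. There are real constants $c_N$, not depending on the candidate model $\lambda$, on the true model and its parameters, or on the data, such that for every $\lambda\in\Lambda$, as $N\to\infty$, $$\mathrm{BMDL}_N(\lambda)-\mathrm{MDL}_N(\lambda)-c_N=O_P(1).$$ -/

import Mathlib

open MeasureTheory ProbabilityTheory Filter Matrix
open scoped Asymptotics

noncomputable section

namespace Changepoint

/-- `Y N = O_P(1)` as `N → ∞`: the sequence is bounded in probability. -/
def IsBigOPOne {Ω : Type*} [MeasurableSpace Ω] (P : Measure Ω) (Y : ℕ → Ω → ℝ) : Prop :=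
  ∀ ε : ℝ, 0 < ε → ∃ K : ℝ, ∀ᶠ N in atTop, P {ω | K < |Y N ω|} ≤ ENNReal.ofReal ε

/-! ### The error process -/

/-- `ε` is a causal AR(p) process driven by the iid mean-zero noise `Z` of variance `σ ^ 2`:
it satisfies the AR recursion and is an absolutely summable one-sided moving average of `Z`.
The coefficient `φ j` stands for `φ_{j+1}`. -/
structure IsCausalAR {Ω : Type*} [MeasurableSpace Ω] (P : Measure Ω) {p : ℕ}
    (φ : Fin p → ℝ) (σ : ℝ) (Z ε : ℤ → Ω → ℝ) : Prop where
  indep : iIndepFun Z P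
  ident : ∀ t, IdentDistrib (Z t) (Z 0) P P
  memLp : MemLp (Z 0) 2 P
  mean_zero : ∫ ω, Z 0 ω ∂P = 0
  variance_eq : variance (Z 0) P = σ ^ 2
  recursion : ∀ t : ℤ, ∀ᵐ ω ∂P,
    ε t ω = ∑ j : Fin p, φ j * ε (t - ((j : ℤ) + 1)) ω + Z t ω
  causal : ∃ ψ : ℕ → ℝ, Summable (fun j => |ψ j|) ∧
    ∀ t : ℤ, ∀ᵐ ω ∂P, HasSum (fun j : ℕ => ψ j * Z (t - j) ω) (ε t ω)

/-! ### Relative changepoint configurations -/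

/-- A relative changepoint configuration `0 < λ_1 < ⋯ < λ_m < 1`; `loc r` is `λ_{r+1}`. -/
structure RelConfig where
  m : ℕ
  loc : Fin m → ℝ
  strictMono : StrictMono loc
  pos : ∀ r, 0 < loc r
  lt_one : ∀ r, loc r < 1

namespace RelConfig

/-- `λ_0 = 0`, `λ_1, …, λ_m`, `λ_{m+1} = 1` (and the value `1` beyond). -/
def ext (l : RelConfig) (r : ℕ) : ℝ :=
  if r = 0 then 0 else if h : r - 1 < l.m then l.loc ⟨r - 1, h⟩ else 1

/-- Changepoint times for sample size `N`: `τ_0 = 1`, `τ_r = ⌊λ_r N⌋` for `1 ≤ r ≤ m`,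
`τ_{m+1} = N + 1`. -/
def tau (l : RelConfig) (N r : ℕ) : ℕ :=
  if r = 0 then 1 else if r ≤ l.m then ⌊l.ext r * N⌋₊ else N + 1

/-- The regime length `N_r = ⌊λ_r N⌋ - ⌊λ_{r-1} N⌋`, for `1 ≤ r ≤ m + 1`. -/
def regimeLen (l : RelConfig) (N r : ℕ) : ℝ :=
  (⌊l.ext r * N⌋₊ : ℝ) - (⌊l.ext (r - 1) * N⌋₊ : ℝ)

/-- The number `m^{(2)}` of documented changepoints, `doc` being the set of documented times. -/
def mDoc (l : RelConfig) (N : ℕ) (doc : Finset ℕ) : ℕ :=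
  ((Finset.Icc 1 l.m).filter (fun r => l.tau N r ∈ doc)).card

/-- The number `m^{(1)}` of undocumented changepoints. -/
def mUndoc (l : RelConfig) (N : ℕ) (doc : Finset ℕ) : ℕ :=
  ((Finset.Icc 1 l.m).filter (fun r => l.tau N r ∉ doc)).card

end RelConfig

/-- The set `Λ` of configurations with at most `M` changepoints and relative spacings at
least `d`. -/
def Lam (M : ℕ) (d : ℝ) : Set RelConfig :=
  {l | l.m ≤ M ∧ ∀ r ∈ Finset.Icc 1 (l.m + 1), d ≤ l.ext r - l.ext (r - 1)}

/-- The number `N^{(2)}` of documented times in `{p+1, …, N}`. -/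
def nDoc (p N : ℕ) (doc : Finset ℕ) : ℕ :=
  ((Finset.Icc (p + 1) N).filter (fun t => t ∈ doc)).card

/-- The number `N^{(1)} = N - p - N^{(2)}` of undocumented times in `{p+1, …, N}`. -/
def nUndoc (p N : ℕ) (doc : Finset ℕ) : ℕ :=
  ((Finset.Icc (p + 1) N).filter (fun t => t ∉ doc)).card

/-! ### Design matrices (entry at time `t ≥ 1`) -/

/-- The season `v(t) = t - T ⌊(t-1)/T⌋ ∈ {1, …, T}` of the time `t ≥ 1`. -/
def season (T t : ℕ) : ℕ := t - T * ((t - 1) / T)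

/-- Seasonal indicator; the column `v : Fin T` belongs to season `v + 1`. -/
def seasonInd (T t : ℕ) (v : Fin T) : ℝ := if season T t = (v : ℕ) + 1 then 1 else 0

/-- Regime indicator; the column `r : Fin m` belongs to regime `r + 2`, which consists of the
times `t` with `τ_{r+1} ≤ t < τ_{r+2}`. -/
def regimeInd (l : RelConfig) (N t : ℕ) (r : Fin l.m) : ℝ :=
  if l.tau N (r + 1) ≤ t ∧ t < l.tau N (r + 2) then 1 else 0

/-- The observation `X_t` in a sample of size `N`: seasonal mean, plus the mean of the regime of
`t` under the true configuration (zero for the first regime, `μ r` for regime `r + 2`),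
plus the error. -/
def obs {Ω : Type*} {T : ℕ} (l0 : RelConfig) (s : Fin T → ℝ) (μ : Fin l0.m → ℝ)
    (ε : ℤ → Ω → ℝ) (N : ℕ) (ω : Ω) (t : ℕ) : ℝ :=
  ∑ v, seasonInd T t v * s v + ∑ r, regimeInd l0 N t r * μ r + ε t ω

/-! ### Least squares and Yule-Walker estimation -/

/-- The column space of a matrix. -/
def colSpace {n : ℕ} {ι : Type*} (A : Matrix (Fin n) ι ℝ) :
    Submodule ℝ (EuclideanSpace ℝ (Fin n)) :=
  Submodule.span ℝ (Set.range fun j => WithLp.toLp 2 fun i => A i j)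

/-- `(I - 𝒫_A) y`, with `𝒫_A` the orthogonal projection onto the column space of `A`. -/
def projResid {n : ℕ} {ι : Type*} (A : Matrix (Fin n) ι ℝ) (y : Fin n → ℝ) : Fin n → ℝ :=
  fun i => y i - (colSpace A).starProjection (WithLp.toLp 2 y) i

/-- The block matrix `[A_{1:N} | D_{1:N}]`; row `i` belongs to time `i + 1`. -/
def designFull (T : ℕ) (l : RelConfig) (N : ℕ) : Matrix (Fin N) (Fin T ⊕ Fin l.m) ℝ :=
  Matrix.of fun i => Sum.elim (seasonInd T (i + 1)) (regimeInd l N (i + 1))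

/-- Ordinary least squares residual at time `t ∈ {1, …, N}` (zero at other times) of the data
`x 1, …, x N`. -/
def olsResid (T : ℕ) (l : RelConfig) (N : ℕ) (x : ℕ → ℝ) (t : ℕ) : ℝ :=
  if h : 1 ≤ t ∧ t ≤ N then
    projResid (designFull T l N) (fun i => x (i + 1)) ⟨t - 1, by omega⟩
  else 0

/-- Sample autocovariance `γ̂(h)` of the residuals. -/
def gammaHat (T : ℕ) (l : RelConfig) (N : ℕ) (x : ℕ → ℝ) (h : ℕ) : ℝ :=
  (N : ℝ)⁻¹ * ∑ t ∈ Finset.Icc (h + 1) N, olsResid T l N x t * olsResid T l N x (t - h)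

/-- The Yule-Walker estimator `φ̂ = Γ̂_p⁻¹ γ̂_p`. -/
def phiHat (p T : ℕ) (l : RelConfig) (N : ℕ) (x : ℕ → ℝ) : Fin p → ℝ :=
  (Matrix.of fun i j : Fin p => gammaHat T l N x ((i : ℤ) - (j : ℤ)).natAbs)⁻¹ *ᵥ
    fun i => gammaHat T l N x (i + 1)

/-- `f_t - ∑_{j=1}^p φ_j f_{t-j}`, for `t > p`. -/
def arFilter {p : ℕ} (φ : Fin p → ℝ) (f : ℕ → ℝ) (t : ℕ) : ℝ :=
  f t - ∑ j : Fin p, φ j * f (t - (j + 1))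

/-- `X̂`; row `i` belongs to time `p + 1 + i`. -/
def XHat (p T : ℕ) (l : RelConfig) (N : ℕ) (x : ℕ → ℝ) : Fin (N - p) → ℝ :=
  fun i => arFilter (phiHat p T l N x) x (p + 1 + i)

/-- `Â`. -/
def AHat (p T : ℕ) (l : RelConfig) (N : ℕ) (x : ℕ → ℝ) : Matrix (Fin (N - p)) (Fin T) ℝ :=
  Matrix.of fun i v => arFilter (phiHat p T l N x) (fun t => seasonInd T t v) (p + 1 + i)

/-- `D̂`. -/
def DHat (p T : ℕ) (l : RelConfig) (N : ℕ) (x : ℕ → ℝ) : Matrix (Fin (N - p)) (Fin l.m) ℝ :=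
  Matrix.of fun i r => arFilter (phiHat p T l N x) (fun t => regimeInd l N t r) (p + 1 + i)

/-- `D̂' D̂ + I_m / ν`. -/
def ridgeGram (p T : ℕ) (ν : ℝ) (l : RelConfig) (N : ℕ) (x : ℕ → ℝ) :
    Matrix (Fin l.m) (Fin l.m) ℝ :=
  (DHat p T l N x)ᵀ * DHat p T l N x + ν⁻¹ • (1 : Matrix (Fin l.m) (Fin l.m) ℝ)

/-- `B̂ = I - D̂ (D̂' D̂ + I_m / ν)⁻¹ D̂'`. -/
def BHat (p T : ℕ) (ν : ℝ) (l : RelConfig) (N : ℕ) (x : ℕ → ℝ) :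
    Matrix (Fin (N - p)) (Fin (N - p)) ℝ :=
  1 - DHat p T l N x * (ridgeGram p T ν l N x)⁻¹ * (DHat p T l N x)ᵀ

/-- `σ̂² = (N - p)⁻¹ X̂' {B̂ - B̂ Â (Â' B̂ Â)⁻¹ Â' B̂} X̂`. -/
def sigmaSqHat (p T : ℕ) (ν : ℝ) (l : RelConfig) (N : ℕ) (x : ℕ → ℝ) : ℝ :=
  let X := XHat p T l N x
  let A := AHat p T l N x
  let B := BHat p T ν l N x
  ((N : ℝ) - p)⁻¹ * (X ⬝ᵥ ((B - B * A * (Aᵀ * B * A)⁻¹ * Aᵀ * B) *ᵥ X))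

/-- `σ̂²_{ν=∞} = (N - p)⁻¹ X̂' (I - 𝒫_{[Â|D̂]}) X̂`. -/
def sigmaSqHatInf (p T : ℕ) (l : RelConfig) (N : ℕ) (x : ℕ → ℝ) : ℝ :=
  ((N : ℝ) - p)⁻¹ * (XHat p T l N x ⬝ᵥ
    projResid (Matrix.fromCols (AHat p T l N x) (DHat p T l N x)) (XHat p T l N x))

/-! ### The two description lengths -/

/-- The Bayesian MDL of the configuration `l` for the data `x 1, …, x N`, with documented
times `doc`. -/
def BMDL (p T : ℕ) (ν a b₁ b₂ : ℝ) (doc : Finset ℕ) (l : RelConfig) (N : ℕ) (x : ℕ → ℝ) : ℝ :=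
  ((N : ℝ) - p) / 2 * Real.log (sigmaSqHat p T ν l N x) + (l.m : ℝ) / 2 * Real.log ν
    + 1 / 2 * Real.log (ridgeGram p T ν l N x).det
    - (Real.log (Real.Gamma (a + l.mUndoc N doc) *
          Real.Gamma (b₁ + nUndoc p N doc - l.mUndoc N doc))
      + Real.log (Real.Gamma (a + l.mDoc N doc) *
          Real.Gamma (b₂ + nDoc p N doc - l.mDoc N doc)))

/-- The automatic MDL of the configuration `l` for the data `x 1, …, x N`. -/
def MDL (p T : ℕ) (l : RelConfig) (N : ℕ) (x : ℕ → ℝ) : ℝ :=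
  ((N : ℝ) - p) / 2 * Real.log (sigmaSqHatInf p T l N x)
    + 1 / 2 * ∑ r ∈ Finset.Icc 2 (l.m + 1), Real.log (l.regimeLen N r)
    + Real.log ((l.m : ℝ) + 1) + ((l.m : ℝ) + 1) * Real.log ((N : ℝ) - p)

end Changepoint

end

/-!
The estimates `σ̂²` and `σ̂²_{ν=∞}` are minima of the penalised and of the plain residual sum of
squares of the same filtered regression, so they differ by at most `ν⁻¹ ‖û‖² / (N - p)`, where `û`
are the least squares regime means. With probability close to one the lag combinations of the data,
centred by any mean function of the candidate model, have sums of squares of exact order `N`. On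
such samples the Yule-Walker filter is bounded, and an energy argument for its Toeplitz Gram matrix,
summed over a period, bounds it from below on periodic sequences; so the filtered design has a Gram
matrix of order `N`. Hence `û` is bounded, the two logarithmic variances differ by `O(1 / N)`, and
`log |D̂'D̂ + I / ν|` and `∑ log N_r` are both `m log N + O(1)`. The Gamma ratios contribute
`-m⁽ᵏ⁾ log N + O(1)` each, up to terms that depend only on `N`.
-/

noncomputable section

namespace Changepoint

/-! ### Stability of Yule-Walker filters -/

section LagPolynomial

variable {R : Type*} [AddCommGroupWithOne R]

/-- The lag polynomial with coefficients `c`, truncated at order `j` and applied to `f`; it is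
indexed by the earliest time `u` that it involves, so that its value belongs to time `u + j`. -/
def partialFilter (c : ℕ → ℝ) (f : R → ℝ) (j : ℕ) (u : R) : ℝ :=
  ∑ i ∈ Finset.range (j + 1), c i * f (u + j - i)

lemma partialFilter_zero (c : ℕ → ℝ) (f : R → ℝ) (u : R) :
    partialFilter c f 0 u = c 0 * f u := by
  simp [partialFilter]

lemma partialFilter_succ (c : ℕ → ℝ) (f : R → ℝ) (j : ℕ) (u : R) :
    partialFilter c f (j + 1) u = partialFilter c f j (u + 1) + c (j + 1) * f u := by
  have hshift (i : ℕ) : u + ((j + 1 : ℕ) : R) - i = u + 1 + j - i := by push_cast; abel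
  simp only [partialFilter, Finset.sum_range_succ _ (j + 1), hshift]
  congr 3
  push_cast
  abel

lemma abs_partialFilter_le {c : ℕ → ℝ} {f : R → ℝ} {C F : ℝ} {j : ℕ}
    (hC : ∀ i ≤ j, |c i| ≤ C) (hF : ∀ u, |f u| ≤ F) (u : R) :
    |partialFilter c f j u| ≤ (j + 1) * (C * F) := by
  have hC₀ : 0 ≤ C := (abs_nonneg _).trans (hC 0 (Nat.zero_le _))
  calc |partialFilter c f j u| ≤ ∑ i ∈ Finset.range (j + 1), |c i * f (u + j - i)| :=
        Finset.abs_sum_le_sum_abs _ _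
    _ ≤ ∑ _i ∈ Finset.range (j + 1), C * F := by
        refine Finset.sum_le_sum fun i hi => ?_
        rw [abs_mul]
        exact mul_le_mul (hC i (Finset.mem_range_succ_iff.1 hi)) (hF _) (abs_nonneg _) hC₀
    _ = (j + 1) * (C * F) := by simp

lemma sum_partialFilter_smul {E : Type*} [AddCommGroup E] [Module ℝ E] (c : ℕ → ℝ) (f : R → ℝ)
    (v : ℕ → E) (u : R) (p : ℕ) :
    ∑ j ∈ Finset.range (p + 1), partialFilter c f j u • v j
      = f u • (∑ i ∈ Finset.range (p + 1), c i • v i)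
        + ∑ j ∈ Finset.range p, partialFilter c f j (u + 1) • v (j + 1) := by
  simp only [Finset.sum_range_succ', partialFilter_succ, partialFilter_zero, add_smul,
    Finset.sum_add_distrib, smul_add, Finset.smul_sum, smul_smul, mul_comm (f u)]
  abel

end LagPolynomial

section Stability

variable {E : Type*} [NormedAddCommGroup E] [InnerProductSpace ℝ E] {v : ℕ → E} {p : ℕ}

lemma norm_sq_sum_smul_shift
    (hv : ∀ i < p, ∀ j < p, inner ℝ (v (i + 1)) (v (j + 1)) = inner ℝ (v i) (v j)) (w : ℕ → ℝ) :
    ‖∑ j ∈ Finset.range p, w j • v (j + 1)‖ ^ 2 = ‖∑ j ∈ Finset.range p, w j • v j‖ ^ 2 := by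
  simp only [← real_inner_self_eq_norm_sq, sum_inner, inner_sum, real_inner_smul_left,
    real_inner_smul_right]
  refine Finset.sum_congr rfl fun i hi => Finset.sum_congr rfl fun j hj => ?_
  rw [hv j (Finset.mem_range.1 hj) i (Finset.mem_range.1 hi)]

variable {R : Type*} [AddCommGroupWithOne R] [Fintype R] {c : ℕ → ℝ}

-- The squared norms of the truncated sums at successive times telescope around the cycle `R`,
-- because a Toeplitz Gram matrix makes the shift `v j ↦ v (j + 1)` isometric.
lemma sum_sq_mul_norm_sq_eq
    (hv : ∀ i < p, ∀ j < p, inner ℝ (v (i + 1)) (v (j + 1)) = inner ℝ (v i) (v j))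
    (horth : ∀ j < p, inner ℝ (∑ i ∈ Finset.range (p + 1), c i • v i) (v (j + 1)) = 0)
    (f : R → ℝ) :
    (∑ u, f u ^ 2) * ‖∑ i ∈ Finset.range (p + 1), c i • v i‖ ^ 2
      = ∑ u, partialFilter c f p u *
        (2 * inner ℝ (∑ j ∈ Finset.range p, partialFilter c f j u • v j) (v p)
          + partialFilter c f p u * ‖v p‖ ^ 2) := by
  set Y := ∑ i ∈ Finset.range (p + 1), c i • v i
  set U : R → E := fun u => ∑ j ∈ Finset.range p, partialFilter c f j u • v j
  set V : R → E := fun u => ∑ j ∈ Finset.range p, partialFilter c f j u • v (j + 1)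
  have hVU : ∑ u, ‖V (u + 1)‖ ^ 2 = ∑ u, ‖U u‖ ^ 2 :=
    (Equiv.sum_comp (Equiv.addRight (1 : R)) fun u => ‖V u‖ ^ 2).trans
      (Finset.sum_congr rfl fun u _ => norm_sq_sum_smul_shift hv _)
  have hYV (u : R) : inner ℝ Y (V u) = 0 := by
    simp only [V, inner_sum, real_inner_smul_right]
    exact Finset.sum_eq_zero fun j hj => by rw [horth j (Finset.mem_range.1 hj), mul_zero]
  have hpyth (u : R) : ‖U u + partialFilter c f p u • v p‖ ^ 2
      = f u ^ 2 * ‖Y‖ ^ 2 + ‖V (u + 1)‖ ^ 2 := by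
    rw [← Finset.sum_range_succ (fun j => partialFilter c f j u • v j), sum_partialFilter_smul,
      norm_add_sq_real, real_inner_smul_left, hYV, norm_smul, mul_pow, Real.norm_eq_abs, sq_abs]
    ring
  calc (∑ u, f u ^ 2) * ‖Y‖ ^ 2
      = ∑ u, (‖U u + partialFilter c f p u • v p‖ ^ 2 - ‖U u‖ ^ 2) := by
        rw [Finset.sum_sub_distrib, Finset.sum_congr rfl fun u _ => hpyth u,
          Finset.sum_add_distrib, hVU, Finset.sum_mul, add_sub_cancel_right]
    _ = _ := by
        refine Finset.sum_congr rfl fun u _ => ?_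
        rw [norm_add_sq_real, real_inner_smul_right, norm_smul, mul_pow, Real.norm_eq_abs, sq_abs]
        ring

lemma abs_two_mul_inner_add_le {g w : ℝ} {x : ℕ → ℝ} (hg : ∀ i ≤ p, ‖v i‖ ^ 2 ≤ g)
    (hx : ∀ i ≤ p, |x i| ≤ w) :
    |2 * inner ℝ (∑ j ∈ Finset.range p, x j • v j) (v p) + x p * ‖v p‖ ^ 2|
      ≤ (2 * p + 1) * (w * g) := by
  have hterm (j : ℕ) (hj : j ≤ p) : |x j * inner ℝ (v j) (v p)| ≤ w * g := by
    rw [abs_mul]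
    refine mul_le_mul (hx j hj) ((abs_real_inner_le_norm _ _).trans ?_) (abs_nonneg _)
      ((abs_nonneg _).trans (hx j hj))
    nlinarith [hg j hj, hg p le_rfl, sq_nonneg (‖v j‖ - ‖v p‖)]
  have hsum : |inner ℝ (∑ j ∈ Finset.range p, x j • v j) (v p)| ≤ p * (w * g) := by
    simp only [sum_inner, real_inner_smul_left]
    calc _ ≤ ∑ j ∈ Finset.range p, |x j * inner ℝ (v j) (v p)| := Finset.abs_sum_le_sum_abs _ _
      _ ≤ ∑ _j ∈ Finset.range p, w * g :=
          Finset.sum_le_sum fun j hj => hterm j (Finset.mem_range.1 hj).le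
      _ = p * (w * g) := by simp
  rw [← real_inner_self_eq_norm_sq (v p)]
  refine (abs_add_le _ _).trans ?_
  rw [abs_mul, abs_two]
  linarith [hterm p le_rfl]

lemma sqrt_sum_sq_mul_norm_sq_le {g C : ℝ}
    (hv : ∀ i < p, ∀ j < p, inner ℝ (v (i + 1)) (v (j + 1)) = inner ℝ (v i) (v j))
    (hC : ∀ i ≤ p, |c i| ≤ C) (hg : ∀ i ≤ p, ‖v i‖ ^ 2 ≤ g)
    (horth : ∀ j < p, inner ℝ (∑ i ∈ Finset.range (p + 1), c i • v i) (v (j + 1)) = 0)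
    (f : R → ℝ) :
    √(∑ u, f u ^ 2) * ‖∑ i ∈ Finset.range (p + 1), c i • v i‖ ^ 2
      ≤ (2 * p + 1) * (p + 1) * (C * g) * ∑ u, |partialFilter c f p u| := by
  set Y := ∑ i ∈ Finset.range (p + 1), c i • v i
  set F := √(∑ u, f u ^ 2)
  have hFsq : F ^ 2 = ∑ u, f u ^ 2 := Real.sq_sqrt (Finset.sum_nonneg fun _ _ => sq_nonneg _)
  have hF (u : R) : |f u| ≤ F := Real.abs_le_sqrt <|
    Finset.single_le_sum (f := fun u => f u ^ 2) (fun _ _ => sq_nonneg _) (Finset.mem_univ u)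
  have hC₀ : 0 ≤ C := (abs_nonneg _).trans (hC 0 (Nat.zero_le _))
  have hg₀ : 0 ≤ g := (sq_nonneg _).trans (hg 0 (Nat.zero_le _))
  have hW (j : ℕ) (hj : j ≤ p) (u : R) : |partialFilter c f j u| ≤ (p + 1) * (C * F) := by
    refine (abs_partialFilter_le (fun i hi => hC i (hi.trans hj)) hF u).trans ?_
    gcongr
  have henergy : F * (F * ‖Y‖ ^ 2)
      ≤ F * ((2 * p + 1) * (p + 1) * (C * g) * ∑ u, |partialFilter c f p u|) := calc
    F * (F * ‖Y‖ ^ 2) = ∑ u, _ := by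
        rw [← mul_assoc, ← sq, hFsq, sum_sq_mul_norm_sq_eq hv horth]
    _ ≤ ∑ u, |partialFilter c f p u| * ((2 * p + 1) * ((p + 1) * (C * F) * g)) := by
        refine Finset.sum_le_sum fun u _ => (le_abs_self _).trans ?_
        rw [abs_mul]
        gcongr
        exact abs_two_mul_inner_add_le hg fun j hj => hW j hj u
    _ = _ := by rw [← Finset.sum_mul]; ring
  rcases (Real.sqrt_nonneg (∑ u, f u ^ 2)).eq_or_lt with h | h
  · simp only [F, ← h, zero_mul]
    positivity
  · exact le_of_mul_le_mul_left henergy h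

lemma norm_sq_mul_sum_sq_le {g C : ℝ}
    (hv : ∀ i < p, ∀ j < p, inner ℝ (v (i + 1)) (v (j + 1)) = inner ℝ (v i) (v j))
    (hC : ∀ i ≤ p, |c i| ≤ C) (hg : ∀ i ≤ p, ‖v i‖ ^ 2 ≤ g)
    (horth : ∀ j < p, inner ℝ (∑ i ∈ Finset.range (p + 1), c i • v i) (v (j + 1)) = 0)
    (f : R → ℝ) :
    (‖∑ i ∈ Finset.range (p + 1), c i • v i‖ ^ 2) ^ 2 * ∑ u, f u ^ 2
      ≤ ((2 * p + 1) * (p + 1) * (C * g)) ^ 2 *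
        (Fintype.card R * ∑ u : R, (∑ i ∈ Finset.range (p + 1), c i * f (u - i)) ^ 2) := by
  set Y := ∑ i ∈ Finset.range (p + 1), c i • v i
  set L := (2 * p + 1) * (p + 1) * (C * g)
  calc (‖Y‖ ^ 2) ^ 2 * ∑ u, f u ^ 2 = (√(∑ u, f u ^ 2) * ‖Y‖ ^ 2) ^ 2 := by
        rw [mul_pow, Real.sq_sqrt (Finset.sum_nonneg fun _ _ => sq_nonneg _), mul_comm]
    _ ≤ (L * ∑ u, |partialFilter c f p u|) ^ 2 :=
        pow_le_pow_left₀ (by positivity) (sqrt_sum_sq_mul_norm_sq_le hv hC hg horth f) 2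
    _ = L ^ 2 * (∑ u, |partialFilter c f p u|) ^ 2 := mul_pow _ _ _
    _ ≤ L ^ 2 * (Fintype.card R * ∑ u, |partialFilter c f p u| ^ 2) := by
        gcongr
        simpa using sq_sum_le_card_mul_sum_sq (s := Finset.univ)
          (f := fun u => |partialFilter c f p u|)
    _ = _ := by
        simp only [sq_abs]
        rw [← Equiv.sum_comp (Equiv.addRight (p : R))
          fun u => (∑ i ∈ Finset.range (p + 1), c i * f (u - i)) ^ 2]
        rfl

end Stability

section OrthogonalCombination

variable {E : Type*} [NormedAddCommGroup E] [InnerProductSpace ℝ E] {v : ℕ → E} {c : ℕ → ℝ}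
  {p : ℕ} {κ g : ℝ}

lemma le_norm_sq_sum_smul (hc : c 0 = 1) (hκ : 0 ≤ κ)
    (hlow : κ * ∑ i ∈ Finset.range (p + 1), c i ^ 2
      ≤ ‖∑ i ∈ Finset.range (p + 1), c i • v i‖ ^ 2) :
    κ ≤ ‖∑ i ∈ Finset.range (p + 1), c i • v i‖ ^ 2 := by
  refine le_trans (le_mul_of_one_le_right hκ ?_) hlow
  simpa [hc] using Finset.single_le_sum (f := fun i => c i ^ 2) (fun _ _ => sq_nonneg _)
    (Finset.mem_range.2 p.succ_pos)

lemma norm_sum_smul_le (hc : c 0 = 1)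
    (horth : ∀ j < p, inner ℝ (∑ i ∈ Finset.range (p + 1), c i • v i) (v (j + 1)) = 0) :
    ‖∑ i ∈ Finset.range (p + 1), c i • v i‖ ≤ ‖v 0‖ := by
  set Y := ∑ i ∈ Finset.range (p + 1), c i • v i
  have hY : ‖Y‖ * ‖Y‖ = inner ℝ Y (v 0) := calc
    ‖Y‖ * ‖Y‖ = inner ℝ Y (∑ i ∈ Finset.range (p + 1), c i • v i) :=
        (real_inner_self_eq_norm_mul_norm Y).symm
    _ = inner ℝ Y (v 0) := by
        rw [inner_sum, Finset.sum_range_succ', Finset.sum_eq_zero, hc, one_smul, zero_add]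
        exact fun j hj => by
          rw [real_inner_smul_right, horth j (Finset.mem_range.1 hj), mul_zero]
  rcases (norm_nonneg Y).eq_or_lt with h | h
  · rw [← h]; exact norm_nonneg _
  · exact le_of_mul_le_mul_left (hY.trans_le (real_inner_le_norm _ _)) h

lemma sum_sq_le_div (hc : c 0 = 1) (hκ : 0 < κ) (hg : ‖v 0‖ ^ 2 ≤ g)
    (hlow : κ * ∑ i ∈ Finset.range (p + 1), c i ^ 2
      ≤ ‖∑ i ∈ Finset.range (p + 1), c i • v i‖ ^ 2)
    (horth : ∀ j < p, inner ℝ (∑ i ∈ Finset.range (p + 1), c i • v i) (v (j + 1)) = 0) :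
    ∑ i ∈ Finset.range (p + 1), c i ^ 2 ≤ g / κ := by
  rw [le_div_iff₀' hκ]
  exact hlow.trans ((pow_le_pow_left₀ (norm_nonneg _) (norm_sum_smul_le hc horth) 2).trans hg)

/-- The square of a bound for the inverse, on `ℓ²` of a cycle of length `n`, of the filter of
order `p` fitted to vectors whose Gram matrix has condition number `L`. -/
def stabilityConst (p : ℕ) (L : ℝ) (n : ℕ) : ℝ := ((2 * p + 1) * (p + 1)) ^ 2 * L ^ 3 * n

lemma stabilityConst_nonneg (n : ℕ) {L : ℝ} (hL : 0 ≤ L) : 0 ≤ stabilityConst p L n := by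
  unfold stabilityConst
  positivity

theorem sum_sq_le_stabilityConst_mul {R : Type*} [AddCommGroupWithOne R] [Fintype R]
    (hc : c 0 = 1) (hκ : 0 < κ) (hg : ∀ i ≤ p, ‖v i‖ ^ 2 ≤ g)
    (hv : ∀ i < p, ∀ j < p, inner ℝ (v (i + 1)) (v (j + 1)) = inner ℝ (v i) (v j))
    (hlow : κ * ∑ i ∈ Finset.range (p + 1), c i ^ 2
      ≤ ‖∑ i ∈ Finset.range (p + 1), c i • v i‖ ^ 2)
    (horth : ∀ j < p, inner ℝ (∑ i ∈ Finset.range (p + 1), c i • v i) (v (j + 1)) = 0)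
    (f : R → ℝ) :
    ∑ u, f u ^ 2 ≤ stabilityConst p (g / κ) (Fintype.card R) *
      ∑ u : R, (∑ i ∈ Finset.range (p + 1), c i * f (u - i)) ^ 2 := by
  have hcoef := sum_sq_le_div hc hκ (hg 0 (Nat.zero_le _)) hlow horth
  have hC (i : ℕ) (hi : i ≤ p) : |c i| ≤ √(g / κ) := Real.abs_le_sqrt <|
    (Finset.single_le_sum (f := fun i => c i ^ 2) (fun _ _ => sq_nonneg _)
      (Finset.mem_range_succ_iff.2 hi)).trans hcoef
  have hL : 0 ≤ g / κ := (Finset.sum_nonneg fun _ _ => sq_nonneg _).trans hcoef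
  refine le_of_mul_le_mul_left ?_ (pow_pos hκ 2)
  calc κ ^ 2 * ∑ u, f u ^ 2
      ≤ (‖∑ i ∈ Finset.range (p + 1), c i • v i‖ ^ 2) ^ 2 * ∑ u, f u ^ 2 := by
        have hY := le_norm_sq_sum_smul hc hκ.le hlow
        have : 0 ≤ ∑ u, f u ^ 2 := Finset.sum_nonneg fun _ _ => sq_nonneg _
        gcongr
    _ ≤ _ := norm_sq_mul_sum_sq_le hv hC hg horth f
    _ = _ := by
        rw [mul_pow, mul_pow _ g, Real.sq_sqrt hL, stabilityConst]
        field_simp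

end OrthogonalCombination

/-! ### Least squares, ridge regression and generalised least squares -/

section LeastSquares

variable {n : ℕ} {ι : Type*} (A : Matrix (Fin n) ι ℝ) (y : Fin n → ℝ)

lemma dotProduct_projResid : y ⬝ᵥ projResid A y = projResid A y ⬝ᵥ projResid A y := by
  have horth := (colSpace A).starProjection_inner_eq_zero (WithLp.toLp 2 y) _
    ((colSpace A).starProjection_apply_mem (WithLp.toLp 2 y))
  have hy : y = projResid A y + (colSpace A).starProjection (WithLp.toLp 2 y) := by
    ext i
    simp [projResid]
  rw [EuclideanSpace.inner_eq_star_dotProduct, star_trivial] at horth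
  nth_rw 1 [hy, add_dotProduct]
  exact add_eq_left.2 horth

variable [Fintype ι]

lemma mem_colSpace_iff {x : EuclideanSpace ℝ (Fin n)} :
    x ∈ colSpace A ↔ ∃ w : ι → ℝ, WithLp.toLp 2 (A *ᵥ w) = x := by
  have hsum (w : ι → ℝ) : (∑ j, w j • WithLp.toLp 2 fun i => A i j : EuclideanSpace ℝ (Fin n))
      = WithLp.toLp 2 (A *ᵥ w) := by
    ext i
    simp [Matrix.mulVec, dotProduct, mul_comm]
  simp only [colSpace, Submodule.mem_span_range_iff_exists_fun, hsum]

lemma exists_projResid_eq : ∃ w : ι → ℝ, projResid A y = y - A *ᵥ w := by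
  obtain ⟨w, hw⟩ :=
    (mem_colSpace_iff A).1 ((colSpace A).starProjection_apply_mem (WithLp.toLp 2 y))
  exact ⟨w, by ext i; simp [projResid, ← hw]⟩

lemma projResid_dotProduct_mulVec (z : ι → ℝ) : projResid A y ⬝ᵥ (A *ᵥ z) = 0 := by
  have horth := (colSpace A).starProjection_inner_eq_zero (WithLp.toLp 2 y) _
    ((mem_colSpace_iff A).2 ⟨z, rfl⟩)
  rw [EuclideanSpace.inner_eq_star_dotProduct, star_trivial, dotProduct_comm] at horth
  exact horth

lemma isLeast_dotProduct_projResid :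
    IsLeast (Set.range fun w : ι → ℝ => (y - A *ᵥ w) ⬝ᵥ (y - A *ᵥ w))
      (y ⬝ᵥ projResid A y) := by
  obtain ⟨w, hw⟩ := exists_projResid_eq A y
  rw [dotProduct_projResid]
  refine ⟨⟨w, by simp only [hw]⟩, ?_⟩
  rintro _ ⟨z, rfl⟩
  have hz : y - A *ᵥ z = projResid A y + A *ᵥ (w - z) := by rw [hw, mulVec_sub]; abel
  have hsq : 0 ≤ (A *ᵥ (w - z)) ⬝ᵥ (A *ᵥ (w - z)) := by
    simpa using dotProduct_star_self_nonneg (A *ᵥ (w - z))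
  simp only [hz, add_dotProduct, dotProduct_add, dotProduct_comm (A *ᵥ (w - z)) (projResid A y),
    projResid_dotProduct_mulVec]
  linarith

end LeastSquares

section Ridge

variable {n m k : Type*} [Fintype n] [Fintype m] [Fintype k]

lemma dotProduct_mulVec_comm {H : Matrix m m ℝ} (hH : Hᵀ = H) (x y : m → ℝ) :
    x ⬝ᵥ (H *ᵥ y) = y ⬝ᵥ (H *ᵥ x) := by
  rw [dotProduct_mulVec, ← mulVec_transpose, hH, dotProduct_comm]

lemma isLeast_quadratic [DecidableEq m] {H : Matrix m m ℝ} (hH : H.PosDef) (b : m → ℝ) (q : ℝ) :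
    IsLeast (Set.range fun u : m → ℝ => q - 2 * (u ⬝ᵥ b) + u ⬝ᵥ (H *ᵥ u))
      (q - b ⬝ᵥ (H⁻¹ *ᵥ b)) := by
  have hsymm : Hᵀ = H := by simpa using hH.isHermitian.eq
  set u₀ := H⁻¹ *ᵥ b
  have hb : b = H *ᵥ u₀ := by
    rw [mulVec_mulVec, mul_nonsing_inv _ ((isUnit_iff_isUnit_det _).1 hH.isUnit), one_mulVec]
  have hsquare (u : m → ℝ) : q - 2 * (u ⬝ᵥ b) + u ⬝ᵥ (H *ᵥ u)
      = q - b ⬝ᵥ u₀ + (u - u₀) ⬝ᵥ (H *ᵥ (u - u₀)) := by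
    rw [dotProduct_comm b, hb, mulVec_sub, sub_dotProduct, dotProduct_sub, dotProduct_sub,
      dotProduct_mulVec_comm hsymm u₀ u]
    ring
  refine ⟨⟨u₀, by simp only [hsquare, sub_self, zero_dotProduct, add_zero]⟩, ?_⟩
  rintro _ ⟨u, rfl⟩
  simp only [hsquare]
  simpa using hH.posSemidef.dotProduct_mulVec_nonneg (u - u₀)

section PenalisedLeastSquares

variable [DecidableEq m] (D : Matrix n m ℝ) (ν : ℝ)

/-- The Gram matrix `D' D + I / ν` of ridge regression on `D` with a `N(0, ν)` prior. -/
abbrev ridge : Matrix m m ℝ := Dᵀ * D + ν⁻¹ • (1 : Matrix m m ℝ)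

/-- The matrix `I - D (D' D + I / ν)⁻¹ D'` of the residual quadratic form of ridge regression. -/
abbrev ridgeResid [DecidableEq n] : Matrix n n ℝ := 1 - D * (ridge D ν)⁻¹ * Dᵀ

lemma dotProduct_ridge (u : m → ℝ) :
    u ⬝ᵥ (ridge D ν *ᵥ u) = (D *ᵥ u) ⬝ᵥ (D *ᵥ u) + ν⁻¹ * (u ⬝ᵥ u) := by
  rw [add_mulVec, dotProduct_add, smul_mulVec, one_mulVec, dotProduct_smul, smul_eq_mul,
    ← mulVec_mulVec, dotProduct_mulVec, vecMul_transpose]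

variable {ν}

lemma ridge_posDef {ι : Type*} [Finite ι] [DecidableEq ι] (D : Matrix n ι ℝ) (hν : 0 < ν) :
    (ridge D ν).PosDef :=
  Matrix.PosDef.posSemidef_add (by simpa using Matrix.posSemidef_conjTranspose_mul_self D)
    (Matrix.PosDef.one.smul (inv_pos.2 hν))

variable [DecidableEq n]

lemma isLeast_dotProduct_ridgeResid (hν : 0 < ν) (y : n → ℝ) :
    IsLeast (Set.range fun u : m → ℝ => (y - D *ᵥ u) ⬝ᵥ (y - D *ᵥ u) + ν⁻¹ * (u ⬝ᵥ u))
      (y ⬝ᵥ (ridgeResid D ν *ᵥ y)) := by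
  have hyD (u : m → ℝ) : y ⬝ᵥ (D *ᵥ u) = u ⬝ᵥ (Dᵀ *ᵥ y) := by
    rw [dotProduct_mulVec, ← mulVec_transpose, dotProduct_comm]
  have hmin := isLeast_quadratic (ridge_posDef D hν) (Dᵀ *ᵥ y) (y ⬝ᵥ y)
  convert hmin using 1
  · congr! 2 with u
    rw [dotProduct_ridge, sub_dotProduct, dotProduct_sub, dotProduct_sub,
      dotProduct_comm (D *ᵥ u) y, hyD]
    ring
  · rw [ridgeResid, sub_mulVec, one_mulVec, dotProduct_sub, ← mulVec_mulVec, ← mulVec_mulVec,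
      hyD, dotProduct_comm (Dᵀ *ᵥ y)]

lemma ridgeResid_posDef (hν : 0 < ν) : (ridgeResid D ν).PosDef := by
  refine Matrix.PosDef.of_dotProduct_mulVec_pos ?_ fun y hy => ?_
  · simp [Matrix.IsHermitian, transpose_nonsing_inv, Matrix.mul_assoc]
  · obtain ⟨u, hu⟩ := (isLeast_dotProduct_ridgeResid D hν y).1
    have hres : 0 ≤ (y - D *ᵥ u) ⬝ᵥ (y - D *ᵥ u) := by
      simpa using dotProduct_star_self_nonneg (y - D *ᵥ u)
    rw [star_trivial, ← hu]
    rcases eq_or_ne u 0 with rfl | hu₀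
    · simpa using (dotProduct_star_self_pos_iff (v := y)).2 hy
    · have hpen : 0 < ν⁻¹ * (u ⬝ᵥ u) := mul_pos (inv_pos.2 hν) <| by
        simpa using (dotProduct_star_self_pos_iff (v := u)).2 hu₀
      exact add_pos_of_nonneg_of_pos hres hpen

end PenalisedLeastSquares

variable [DecidableEq k]

lemma isLeast_gls {B : Matrix n n ℝ} (hB : B.PosDef) {A : Matrix n k ℝ}
    (hA : Function.Injective A.mulVec) (x : n → ℝ) :
    IsLeast (Set.range fun s : k → ℝ => (x - A *ᵥ s) ⬝ᵥ (B *ᵥ (x - A *ᵥ s)))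
      (x ⬝ᵥ ((B - B * A * (Aᵀ * B * A)⁻¹ * Aᵀ * B) *ᵥ x)) := by
  have hsymm : Bᵀ = B := by simpa using hB.isHermitian.eq
  have hxA (s : k → ℝ) : x ⬝ᵥ (B *ᵥ (A *ᵥ s)) = s ⬝ᵥ (Aᵀ *ᵥ (B *ᵥ x)) := by
    rw [dotProduct_mulVec_comm hsymm, dotProduct_mulVec s Aᵀ, vecMul_transpose]
  have hH : (Aᵀ * B * A).PosDef := by simpa using hB.conjTranspose_mul_mul_same hA
  have hmin := isLeast_quadratic hH (Aᵀ *ᵥ (B *ᵥ x)) (x ⬝ᵥ (B *ᵥ x))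
  convert hmin using 1
  · congr! 2 with s
    have hAA : (A *ᵥ s) ⬝ᵥ (B *ᵥ (A *ᵥ s)) = s ⬝ᵥ ((Aᵀ * B * A) *ᵥ s) := by
      rw [← mulVec_mulVec, ← mulVec_mulVec, dotProduct_mulVec s Aᵀ, vecMul_transpose]
    rw [mulVec_sub, sub_dotProduct, dotProduct_sub, dotProduct_sub,
      dotProduct_mulVec_comm hsymm (A *ᵥ s) x, hxA, hAA]
    ring
  · have hproj : (B * A * (Aᵀ * B * A)⁻¹ * Aᵀ * B) *ᵥ x
        = B *ᵥ (A *ᵥ ((Aᵀ * B * A)⁻¹ *ᵥ (Aᵀ *ᵥ (B *ᵥ x)))) := by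
      simp only [mulVec_mulVec, Matrix.mul_assoc]
    rw [sub_mulVec, dotProduct_sub, hproj, hxA, dotProduct_comm (Aᵀ *ᵥ (B *ᵥ x))]

lemma isLeast_gls_ridgeResid [DecidableEq n] [DecidableEq m] {A : Matrix n k ℝ}
    (hA : Function.Injective A.mulVec) (D : Matrix n m ℝ) {ν : ℝ} (hν : 0 < ν) (x : n → ℝ) :
    IsLeast (Set.range fun w : (k → ℝ) × (m → ℝ) =>
        (x - A *ᵥ w.1 - D *ᵥ w.2) ⬝ᵥ (x - A *ᵥ w.1 - D *ᵥ w.2) + ν⁻¹ * (w.2 ⬝ᵥ w.2))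
      (x ⬝ᵥ ((ridgeResid D ν - ridgeResid D ν * A * (Aᵀ * ridgeResid D ν * A)⁻¹ * Aᵀ *
        ridgeResid D ν) *ᵥ x)) := by
  obtain ⟨⟨s, hs⟩, hgls⟩ := isLeast_gls (ridgeResid_posDef D hν) hA x
  obtain ⟨u, hu⟩ := (isLeast_dotProduct_ridgeResid D hν (x - A *ᵥ s)).1
  refine ⟨⟨(s, u), hu.trans hs⟩, ?_⟩
  rintro _ ⟨w, rfl⟩
  exact (hgls ⟨w.1, rfl⟩).trans
    ((isLeast_dotProduct_ridgeResid D hν (x - A *ᵥ w.1)).2 ⟨w.2, rfl⟩)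

end Ridge

/-! ### Lag sums and samples with nondegenerate lags -/

/-- The mean function with seasonal means `s` and regime means `μ`. -/
def fitted (T : ℕ) (l : RelConfig) (N : ℕ) (s : Fin T → ℝ) (μ : Fin l.m → ℝ) (t : ℕ) : ℝ :=
  ∑ v, seasonInd T t v * s v + ∑ r, regimeInd l N t r * μ r

/-- The lag polynomial of order `p` with coefficients `a`, applied to `f`. It is meaningful for
`t ≥ p`, where no subtraction is truncated. -/
def lagSum (p : ℕ) (a : ℕ → ℝ) (f : ℕ → ℝ) (t : ℕ) : ℝ :=
  ∑ i ∈ Finset.range (p + 1), a i * f (t - i)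

/-- The event on which all estimates of the comparison are deterministic: the sample has second
moment at most `G`, and after removal of any mean function of the configuration `l` its lag
combinations are nondegenerate with constant `κ`. -/
structure GoodSample (p T : ℕ) (l : RelConfig) (N : ℕ) (x : ℕ → ℝ) (κ G : ℝ) : Prop where
  upper : ∑ t ∈ Finset.Icc 1 N, x t ^ 2 ≤ G * N
  lower : ∀ (a : ℕ → ℝ) (s : Fin T → ℝ) (μ : Fin l.m → ℝ),
    κ * N * ∑ i ∈ Finset.range (p + 1), a i ^ 2 ≤
      ∑ t ∈ Finset.Icc (p + 1) N, lagSum p a (fun t => x t - fitted T l N s μ t) t ^ 2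

/-- The coefficients `1, -φ_1, …, -φ_p` of the autoregressive filter. -/
def arCoeff {p : ℕ} (φ : Fin p → ℝ) : ℕ → ℝ
  | 0 => 1
  | i + 1 => if h : i < p then -φ ⟨i, h⟩ else 0

lemma sum_range_arCoeff_smul {p : ℕ} (φ : Fin p → ℝ) {E : Type*} [AddCommGroup E] [Module ℝ E]
    (v : ℕ → E) :
    ∑ i ∈ Finset.range (p + 1), arCoeff φ i • v i = v 0 - ∑ j : Fin p, φ j • v (j + 1) := by
  rw [Finset.sum_range_succ', Finset.sum_range]
  simp [arCoeff, sub_eq_neg_add]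

lemma arFilter_eq_lagSum {p : ℕ} (φ : Fin p → ℝ) (f : ℕ → ℝ) (t : ℕ) :
    arFilter φ f t = lagSum p (arCoeff φ) f t :=
  (sum_range_arCoeff_smul φ fun i => f (t - i)).symm

lemma sum_Icc_sub_le_sum_Icc {g : ℕ → ℝ} (hg : ∀ t, 0 ≤ g t) {p i : ℕ} (hi : i ≤ p) (q N : ℕ) :
    ∑ t ∈ Finset.Icc (q + p + 1) N, g (t - i) ≤ ∑ t ∈ Finset.Icc (q + 1) N, g t := by
  have hinj : Set.InjOn (fun t => t - i) (Finset.Icc (q + p + 1) N) := fun t ht t' ht' h => by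
    simp only [Finset.coe_Icc, Set.mem_Icc] at ht ht' h
    omega
  rw [← Finset.sum_image hinj (f := g)]
  refine Finset.sum_le_sum_of_subset_of_nonneg (fun t ht => ?_) fun t _ _ => hg t
  simp only [Finset.mem_image, Finset.mem_Icc] at ht ⊢
  omega

lemma sum_lagSum_sq_le (p : ℕ) (a f : ℕ → ℝ) (q N : ℕ) :
    ∑ t ∈ Finset.Icc (q + p + 1) N, lagSum p a f t ^ 2
      ≤ (∑ i ∈ Finset.range (p + 1), a i ^ 2) * ((p + 1) * ∑ t ∈ Finset.Icc (q + 1) N, f t ^ 2) :=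
  calc _ ≤ ∑ t ∈ Finset.Icc (q + p + 1) N, (∑ i ∈ Finset.range (p + 1), a i ^ 2) *
          ∑ i ∈ Finset.range (p + 1), f (t - i) ^ 2 :=
        Finset.sum_le_sum fun t _ => Finset.sum_mul_sq_le_sq_mul_sq _ _ _
    _ = (∑ i ∈ Finset.range (p + 1), a i ^ 2) *
          ∑ i ∈ Finset.range (p + 1), ∑ t ∈ Finset.Icc (q + p + 1) N, f (t - i) ^ 2 := by
        rw [← Finset.mul_sum, Finset.sum_comm]
    _ ≤ (∑ i ∈ Finset.range (p + 1), a i ^ 2) *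
          ∑ i ∈ Finset.range (p + 1), ∑ t ∈ Finset.Icc (q + 1) N, f t ^ 2 := by
        have : 0 ≤ ∑ i ∈ Finset.range (p + 1), a i ^ 2 :=
          Finset.sum_nonneg fun _ _ => sq_nonneg _
        gcongr with i hi
        exact sum_Icc_sub_le_sum_Icc (fun t => sq_nonneg (f t)) (Finset.mem_range_succ_iff.1 hi) q N
    _ = _ := by simp

/-! ### Ordinary least squares residuals -/

lemma designFull_mulVec (T : ℕ) (l : RelConfig) (N : ℕ) (w : Fin T ⊕ Fin l.m → ℝ) (i : Fin N) :
    (designFull T l N *ᵥ w) i = fitted T l N (w ∘ Sum.inl) (w ∘ Sum.inr) (i + 1) := by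
  simp [designFull, mulVec, dotProduct, fitted]

lemma olsResid_zero (T : ℕ) (l : RelConfig) (N : ℕ) (x : ℕ → ℝ) : olsResid T l N x 0 = 0 := by
  simp [olsResid]

lemma olsResid_of_lt (T : ℕ) (l : RelConfig) {N : ℕ} (x : ℕ → ℝ) {t : ℕ} (h : N < t) :
    olsResid T l N x t = 0 := by
  rw [olsResid, dif_neg (by omega)]

lemma olsResid_succ (T : ℕ) (l : RelConfig) {N : ℕ} (x : ℕ → ℝ) (i : Fin N) :
    olsResid T l N x (i + 1) = projResid (designFull T l N) (fun i => x (i + 1)) i := by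
  rw [olsResid, dif_pos ⟨by omega, by omega⟩]
  rfl

lemma sum_Icc_eq_sum_fin (q n : ℕ) (f : ℕ → ℝ) :
    ∑ t ∈ Finset.Icc (q + 1) (q + n), f t = ∑ k : Fin n, f (k + (q + 1)) := by
  rw [← Finset.sum_range (fun k => f (k + (q + 1))), ← Finset.Ico_add_one_right_eq_Icc,
    Finset.sum_Ico_eq_sum_range, add_right_comm, Nat.add_sub_cancel_left]
  simp only [add_comm]

lemma sum_Icc_one_eq_sum_fin (N : ℕ) (f : ℕ → ℝ) :
    ∑ t ∈ Finset.Icc 1 N, f t = ∑ i : Fin N, f (i + 1) := by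
  simpa using sum_Icc_eq_sum_fin 0 N f

lemma exists_olsResid_eq_sub_fitted (T : ℕ) (l : RelConfig) (N : ℕ) (x : ℕ → ℝ) :
    ∃ (s : Fin T → ℝ) (μ : Fin l.m → ℝ), ∀ t ∈ Finset.Icc 1 N,
      olsResid T l N x t = x t - fitted T l N s μ t := by
  obtain ⟨w, hw⟩ := exists_projResid_eq (designFull T l N) fun i => x (i + 1)
  refine ⟨w ∘ Sum.inl, w ∘ Sum.inr, fun t ht => ?_⟩
  obtain ⟨h₁, h₂⟩ := Finset.mem_Icc.1 ht
  obtain ⟨k, rfl⟩ := Nat.exists_eq_add_of_le' h₁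
  exact (olsResid_succ T l x ⟨k, h₂⟩).trans <| by rw [hw, Pi.sub_apply, designFull_mulVec]

lemma sum_olsResid_sq_le (T : ℕ) (l : RelConfig) (N : ℕ) (x : ℕ → ℝ) :
    ∑ t ∈ Finset.Icc 1 N, olsResid T l N x t ^ 2 ≤ ∑ t ∈ Finset.Icc 1 N, x t ^ 2 := by
  have hmin := (isLeast_dotProduct_projResid (designFull T l N) fun i => x (i + 1)).2 ⟨0, rfl⟩
  rw [dotProduct_projResid] at hmin
  simpa [sum_Icc_one_eq_sum_fin, olsResid_succ, dotProduct, ← sq] using hmin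

/-! ### Lag vectors and the Yule-Walker equations -/

/-- The sequence `e` delayed by `i` and observed at the times `q + 1, …, q + n`; times before `0`
are truncated to `0`. -/
def lagVec (q n i : ℕ) (e : ℕ → ℝ) : EuclideanSpace ℝ (Fin n) :=
  WithLp.toLp 2 fun k => e (k + (q + 1) - i)

lemma norm_sq_lagVec (q n : ℕ) (e : ℕ → ℝ) :
    ‖lagVec q n 0 e‖ ^ 2 = ∑ t ∈ Finset.Icc (q + 1) (q + n), e t ^ 2 := by
  simp [EuclideanSpace.norm_sq_eq, lagVec, sum_Icc_eq_sum_fin]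

lemma lagVec_add (q n i : ℕ) (e f : ℕ → ℝ) :
    lagVec q n i (fun t => e t + f t) = lagVec q n i e + lagVec q n i f := rfl

lemma lagVec_sum_smul (q n i : ℕ) {ι : Type*} (s : Finset ι) (a : ι → ℝ) (e : ι → ℕ → ℝ) :
    lagVec q n i (fun t => ∑ c ∈ s, a c * e c t) = ∑ c ∈ s, a c • lagVec q n i (e c) := by
  ext k
  simp [lagVec]

lemma lagVec_lagSum (q n i p : ℕ) (a e : ℕ → ℝ) :
    lagVec q n i (lagSum p a e) = ∑ j ∈ Finset.range (p + 1), a j • lagVec q n (i + j) e := by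
  ext k
  simp [lagVec, lagSum, Nat.sub_sub]

lemma norm_sq_sum_smul_lagVec (n p : ℕ) (a e : ℕ → ℝ) :
    ‖∑ i ∈ Finset.range (p + 1), a i • lagVec 0 n i e‖ ^ 2
      = ∑ t ∈ Finset.Icc 1 n, lagSum p a e t ^ 2 := by
  simpa [lagVec_lagSum] using norm_sq_lagVec 0 n (lagSum p a e)

lemma inner_lagVec_of_le {e : ℕ → ℝ} {N : ℕ} (h₀ : e 0 = 0) (hN : ∀ t, N < t → e t = 0)
    {i j p : ℕ} (hij : i ≤ j) (hi : i ≤ p) :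
    inner ℝ (lagVec 0 (N + p) i e) (lagVec 0 (N + p) j e)
      = ∑ t ∈ Finset.Icc (j - i + 1) N, e t * e (t - (j - i)) := by
  have hinner : inner ℝ (lagVec 0 (N + p) i e) (lagVec 0 (N + p) j e)
      = ∑ t ∈ Finset.Icc 1 (N + p), e (t - i) * e (t - j) := by
    simp [sum_Icc_one_eq_sum_fin, lagVec, PiLp.inner_apply, mul_comm]
  have hshift : ∑ t ∈ Finset.Icc (j - i + 1) N, e t * e (t - (j - i))
      = ∑ t ∈ (Finset.Icc (j - i + 1) N).image (· + i), e (t - i) * e (t - j) := by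
    rw [Finset.sum_image (add_left_injective i).injOn]
    refine Finset.sum_congr rfl fun t _ => ?_
    rw [Nat.add_sub_cancel, show t + i - j = t - (j - i) by omega]
  rw [hinner, hshift]
  refine (Finset.sum_subset (fun t ht => ?_) fun t _ hnt => ?_).symm
  · simp only [Finset.mem_image, Finset.mem_Icc] at ht ⊢
    omega
  · simp only [Finset.mem_image, Finset.mem_Icc, not_exists, not_and] at hnt
    rcases le_or_gt t j with htj | htj
    · rw [Nat.sub_eq_zero_of_le htj, h₀, mul_zero]
    · rw [hN (t - i) (by by_contra h; exact hnt (t - i) (by omega) (by omega)), zero_mul]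

section YuleWalker

variable {p T : ℕ} {l : RelConfig} {N : ℕ} {x : ℕ → ℝ} {κ G : ℝ}

lemma inner_lagVec_olsResid (hN : 0 < N) {i j : ℕ} (hi : i ≤ p) (hj : j ≤ p) :
    inner ℝ (lagVec 0 (N + p) i (olsResid T l N x)) (lagVec 0 (N + p) j (olsResid T l N x))
      = N * gammaHat T l N x ((i : ℤ) - j).natAbs := by
  have hN₀ : (N : ℝ) ≠ 0 := by exact_mod_cast hN.ne'
  rw [gammaHat, mul_inv_cancel_left₀ hN₀]
  rcases le_total i j with h | h
  · rw [inner_lagVec_of_le (olsResid_zero T l N x) (fun _ => olsResid_of_lt T l x) h hi,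
      show ((i : ℤ) - j).natAbs = j - i by omega]
  · rw [real_inner_comm, inner_lagVec_of_le (olsResid_zero T l N x)
      (fun _ => olsResid_of_lt T l x) h hj, show ((i : ℤ) - j).natAbs = i - j by omega]

lemma yuleWalker_orthogonal (hN : 0 < N)
    (hdet : IsUnit (of fun i j : Fin p => gammaHat T l N x ((i : ℤ) - (j : ℤ)).natAbs).det)
    {j : ℕ} (hj : j < p) :
    inner ℝ (∑ i ∈ Finset.range (p + 1),
        arCoeff (phiHat p T l N x) i • lagVec 0 (N + p) i (olsResid T l N x))
      (lagVec 0 (N + p) (j + 1) (olsResid T l N x)) = 0 := by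
  have hYW : (of fun i j : Fin p => gammaHat T l N x ((i : ℤ) - (j : ℤ)).natAbs) *ᵥ
      phiHat p T l N x = fun i : Fin p => gammaHat T l N x (i + 1) := by
    rw [phiHat, mulVec_mulVec, Matrix.mul_nonsing_inv _ hdet, one_mulVec]
  have hrow := congrFun hYW ⟨j, hj⟩
  simp only [mulVec, dotProduct, of_apply] at hrow
  rw [sum_range_arCoeff_smul, inner_sub_left, sum_inner,
    inner_lagVec_olsResid hN (Nat.zero_le _) hj, sub_eq_zero,
    show (((0 : ℕ) : ℤ) - ((j + 1 : ℕ) : ℤ)).natAbs = j + 1 by omega, ← hrow, Finset.mul_sum]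
  refine Finset.sum_congr rfl fun i _ => ?_
  rw [real_inner_smul_left, inner_lagVec_olsResid hN i.2 hj,
    show (((i + 1 : ℕ) : ℤ) - ((j + 1 : ℕ) : ℤ)).natAbs = ((j : ℤ) - i).natAbs by omega]
  ring

namespace GoodSample

lemma norm_sq_lagVec_le (h : GoodSample p T l N x κ G) {i : ℕ} (hi : i ≤ p) :
    ‖lagVec 0 (N + p) i (olsResid T l N x)‖ ^ 2 ≤ G * N := by
  rw [← real_inner_self_eq_norm_sq, inner_lagVec_of_le (olsResid_zero T l N x)
    (fun _ => olsResid_of_lt T l x) le_rfl hi]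
  simp only [Nat.sub_self, Nat.sub_zero, zero_add, ← sq]
  exact (sum_olsResid_sq_le T l N x).trans h.upper

lemma le_norm_sq_sum_smul_lagVec (h : GoodSample p T l N x κ G) (a : ℕ → ℝ) :
    κ * N * ∑ i ∈ Finset.range (p + 1), a i ^ 2
      ≤ ‖∑ i ∈ Finset.range (p + 1), a i • lagVec 0 (N + p) i (olsResid T l N x)‖ ^ 2 := by
  obtain ⟨s, μ, hsμ⟩ := exists_olsResid_eq_sub_fitted T l N x
  rw [norm_sq_sum_smul_lagVec]
  calc κ * N * ∑ i ∈ Finset.range (p + 1), a i ^ 2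
      ≤ ∑ t ∈ Finset.Icc (p + 1) N, lagSum p a (fun t => x t - fitted T l N s μ t) t ^ 2 :=
        h.lower a s μ
    _ = ∑ t ∈ Finset.Icc (p + 1) N, lagSum p a (olsResid T l N x) t ^ 2 := by
        refine Finset.sum_congr rfl fun t ht => congrArg (· ^ 2) ?_
        refine Finset.sum_congr rfl fun i hi => ?_
        have ht := Finset.mem_Icc.1 ht
        have hi := Finset.mem_range.1 hi
        rw [hsμ (t - i) (Finset.mem_Icc.2 (by omega))]
    _ ≤ ∑ t ∈ Finset.Icc 1 (N + p), lagSum p a (olsResid T l N x) t ^ 2 :=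
        Finset.sum_le_sum_of_subset_of_nonneg (Finset.Icc_subset_Icc (by omega) (by omega))
          fun _ _ _ => sq_nonneg _

lemma gammaMatrix_posDef (h : GoodSample p T l N x κ G) (hN : 0 < N) (hκ : 0 < κ) :
    (of fun i j : Fin p => gammaHat T l N x ((i : ℤ) - (j : ℤ)).natAbs).PosDef := by
  refine Matrix.PosDef.of_dotProduct_mulVec_pos ?_ fun b hb => ?_
  · ext i j
    simp only [conjTranspose_apply, of_apply, star_trivial]
    congr 1; omega
  have hN₀ : (0 : ℝ) < N := by exact_mod_cast hN
  have hlow := h.le_norm_sq_sum_smul_lagVec fun i => if hi : i < p then b ⟨i, hi⟩ else 0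
  simp only [Finset.sum_range_succ _ p, Finset.sum_range, Fin.is_lt, dite_true, lt_self_iff_false,
    dite_false, zero_smul, add_zero, ne_eq, OfNat.ofNat_ne_zero, not_false_eq_true, zero_pow,
    Fin.eta] at hlow
  have hform : ‖∑ i : Fin p, b i • lagVec 0 (N + p) i (olsResid T l N x)‖ ^ 2 = N *
      (b ⬝ᵥ ((of fun i j : Fin p => gammaHat T l N x ((i : ℤ) - (j : ℤ)).natAbs) *ᵥ b)) := by
    simp only [← real_inner_self_eq_norm_sq, sum_inner, inner_sum, real_inner_smul_left,
      real_inner_smul_right, dotProduct, mulVec, of_apply, Finset.mul_sum]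
    refine Finset.sum_congr rfl fun i _ => Finset.sum_congr rfl fun j _ => ?_
    rw [inner_lagVec_olsResid hN j.2.le i.2.le,
      show ((j : ℤ) - i).natAbs = ((i : ℤ) - j).natAbs by omega]
    ring
  have hb₀ : 0 < ∑ i, b i ^ 2 := by
    simpa [dotProduct, ← sq] using (dotProduct_star_self_pos_iff (v := b)).2 hb
  rw [star_trivial]
  rw [hform] at hlow
  exact pos_of_mul_pos_right (lt_of_lt_of_le (by positivity) hlow) hN₀.le

lemma inner_filter_lagVec_eq_zero (h : GoodSample p T l N x κ G) (hN : 0 < N) (hκ : 0 < κ) (j : ℕ)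
    (hj : j < p) :
    inner ℝ (∑ i ∈ Finset.range (p + 1),
        arCoeff (phiHat p T l N x) i • lagVec 0 (N + p) i (olsResid T l N x))
      (lagVec 0 (N + p) (j + 1) (olsResid T l N x)) = 0 :=
  yuleWalker_orthogonal hN ((isUnit_iff_isUnit_det _).1 (h.gammaMatrix_posDef hN hκ).isUnit) hj

lemma sum_arCoeff_sq_le (h : GoodSample p T l N x κ G) (hN : 0 < N) (hκ : 0 < κ) :
    ∑ i ∈ Finset.range (p + 1), arCoeff (phiHat p T l N x) i ^ 2 ≤ G / κ := by
  have hN₀ : (0 : ℝ) < N := by exact_mod_cast hN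
  rw [← mul_div_mul_right G κ hN₀.ne']
  exact sum_sq_le_div rfl (by positivity) (h.norm_sq_lagVec_le (Nat.zero_le p))
    (h.le_norm_sq_sum_smul_lagVec _) (h.inner_filter_lagVec_eq_zero hN hκ)

theorem sum_sq_le_yuleWalker_filter [NeZero T] (h : GoodSample p T l N x κ G) (hN : 0 < N)
    (hκ : 0 < κ) (f : ZMod T → ℝ) :
    ∑ u, f u ^ 2 ≤ stabilityConst p (G / κ) T * ∑ u : ZMod T,
      (∑ i ∈ Finset.range (p + 1), arCoeff (phiHat p T l N x) i * f (u - i)) ^ 2 := by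
  have hN₀ : (0 : ℝ) < N := by exact_mod_cast hN
  have hstab := sum_sq_le_stabilityConst_mul (R := ZMod T) rfl (by positivity)
    (fun i hi => h.norm_sq_lagVec_le hi) (fun i hi j hj => by
      rw [inner_lagVec_olsResid hN hi hj, inner_lagVec_olsResid hN hi.le hj.le]
      congr 2; omega)
    (h.le_norm_sq_sum_smul_lagVec _) (h.inner_filter_lagVec_eq_zero hN hκ) f
  rwa [ZMod.card, mul_div_mul_right G κ hN₀.ne'] at hstab

end GoodSample

end YuleWalker

/-! ### Regimes and periodic sequences -/

namespace RelConfig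

lemma ext_of_lt (l : RelConfig) {r : ℕ} (hr : l.m < r) : l.ext r = 1 := by
  rw [ext, if_neg (by omega), dif_neg (by omega)]

lemma ext_nonneg (l : RelConfig) (r : ℕ) : 0 ≤ l.ext r := by
  unfold ext
  split_ifs with h₁ h₂
  exacts [le_rfl, (l.pos _).le, zero_le_one]

lemma ext_le_one (l : RelConfig) (r : ℕ) : l.ext r ≤ 1 := by
  unfold ext
  split_ifs with h₁ h₂
  exacts [zero_le_one, (l.lt_one _).le, le_rfl]

lemma ext_lt_ext_succ (l : RelConfig) {r : ℕ} (hr : r ≤ l.m) : l.ext r < l.ext (r + 1) := by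
  rcases r with _ | r
  · unfold ext
    split_ifs <;> simp_all [l.pos]
  · rcases hr.lt_or_eq with hr | hr
    · simpa [ext, hr, show r < l.m by omega]
        using l.strictMono (Fin.mk_lt_mk.2 (Nat.lt_succ_self r))
    · rw [l.ext_of_lt (r := r + 1 + 1) (by omega)]
      simpa [ext, show r < l.m by omega] using l.lt_one _

lemma exists_le_ext_sub (l : RelConfig) :
    ∃ d : ℝ, 0 < d ∧ ∀ r ≤ l.m, d ≤ l.ext (r + 1) - l.ext r := by
  obtain ⟨r₀, hr₀, hmin⟩ := (Finset.range (l.m + 1)).exists_min_image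
    (fun r => l.ext (r + 1) - l.ext r) Finset.nonempty_range_add_one
  exact ⟨_, sub_pos.2 (l.ext_lt_ext_succ (Finset.mem_range_succ_iff.1 hr₀)),
    fun r hr => hmin r (Finset.mem_range_succ_iff.2 hr)⟩

lemma tau_zero (l : RelConfig) (N : ℕ) : l.tau N 0 = 1 := by simp [tau]

lemma tau_of_lt (l : RelConfig) (N : ℕ) {r : ℕ} (hr : l.m < r) : l.tau N r = N + 1 := by
  rw [tau, if_neg (by omega), if_neg (by omega)]

lemma tau_le_ext (l : RelConfig) (N : ℕ) {r : ℕ} (hr : r ≤ l.m) :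
    (l.tau N r : ℝ) ≤ l.ext r * N + 1 := by
  rcases Nat.eq_zero_or_pos r with rfl | h
  · simp [tau, ext]
  · rw [tau, if_neg h.ne', if_pos hr]
    exact (Nat.floor_le (mul_nonneg (l.ext_nonneg r) N.cast_nonneg)).trans (by linarith)

lemma ext_le_tau (l : RelConfig) (N : ℕ) {r : ℕ} (hr : 1 ≤ r) :
    l.ext r * N - 1 ≤ l.tau N r := by
  rcases le_or_gt r l.m with h | h
  · rw [tau, if_neg (by omega), if_pos h]
    exact (Nat.sub_one_lt_floor _).le
  · rw [l.tau_of_lt N h, l.ext_of_lt h]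
    push_cast
    linarith

lemma exists_le_tau_sub (l : RelConfig) :
    ∃ d : ℝ, 0 < d ∧ ∀ N, ∀ r ≤ l.m, d * N - 2 ≤ (l.tau N (r + 1) : ℝ) - l.tau N r := by
  obtain ⟨d, hd, hgap⟩ := l.exists_le_ext_sub
  refine ⟨d, hd, fun N r hr => ?_⟩
  have hN := mul_le_mul_of_nonneg_right (hgap r hr) (N.cast_nonneg (α := ℝ))
  linarith [l.tau_le_ext N hr, l.ext_le_tau N (Nat.succ_pos r)]

lemma eventually_monotone_tau (l : RelConfig) : ∀ᶠ N in atTop, Monotone (l.tau N) := by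
  obtain ⟨d, hd, hlen⟩ := l.exists_le_tau_sub
  filter_upwards [(tendsto_natCast_atTop_atTop.const_mul_atTop hd).eventually_ge_atTop 2] with N hN
  refine monotone_nat_of_le_succ fun r => ?_
  rcases le_or_gt r l.m with hr | hr
  · exact_mod_cast (sub_nonneg.1 (by linarith [hlen N r hr]) : (l.tau N r : ℝ) ≤ l.tau N (r + 1))
  · rw [l.tau_of_lt N hr, l.tau_of_lt N (hr.trans (Nat.lt_succ_self r))]

lemma exists_mul_le_periods (l : RelConfig) (p : ℕ) {T : ℕ} (hT : 0 < T) :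
    ∃ d : ℝ, 0 < d ∧ ∀ᶠ N : ℕ in atTop, ∀ r ≤ l.m,
      ∃ q : ℕ, d * N ≤ q ∧ l.tau N r + p + q * T ≤ l.tau N (r + 1) := by
  obtain ⟨d, hd, hlen⟩ := l.exists_le_tau_sub
  have hT' : (0 : ℝ) < T := by exact_mod_cast hT
  refine ⟨d / (2 * T), by positivity, ?_⟩
  filter_upwards [(tendsto_natCast_atTop_atTop.const_mul_atTop hd).eventually_ge_atTop
    (2 * (2 + p + T) : ℝ)] with N hN r hr
  have hp : l.tau N r + p ≤ l.tau N (r + 1) := by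
    have : (l.tau N r + p : ℝ) ≤ l.tau N (r + 1) := by linarith [hlen N r hr]
    exact_mod_cast this
  obtain ⟨k, hk⟩ := Nat.exists_eq_add_of_le hp
  refine ⟨k / T, ?_, by rw [hk]; gcongr; exact Nat.div_mul_le_self k T⟩
  have hkT : (k : ℝ) < (k / T : ℕ) * T + T := by exact_mod_cast Nat.lt_div_mul_add hT
  have hkN : (l.tau N (r + 1) : ℝ) = l.tau N r + p + k := by exact_mod_cast hk
  rw [div_mul_eq_mul_div, div_le_iff₀ (by positivity)]
  linarith [hlen N r hr]

end RelConfig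

/-- The mean of regime `r + 1` relative to that of the first regime. -/
def regimeMean (l : RelConfig) (μ : Fin l.m → ℝ) : ℕ → ℝ
  | 0 => 0
  | r + 1 => if h : r < l.m then μ ⟨r, h⟩ else 0

lemma season_eq (T : ℕ) {t : ℕ} (ht : 1 ≤ t) : season T t = (t - 1) % T + 1 := by
  rw [season, Nat.mod_eq_sub_mul_div]
  have := Nat.mul_div_le (t - 1) T
  omega

section Season

variable {T : ℕ} [NeZero T]

/-- The seasonal means as a function on `ℤ / T`, time `1` being in the first season. -/
def seasonMean (s : Fin T → ℝ) (u : ZMod T) : ℝ := s ⟨(u - 1).val, ZMod.val_lt _⟩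

lemma sum_seasonInd_mul (s : Fin T → ℝ) {t : ℕ} (ht : 1 ≤ t) :
    ∑ v, seasonInd T t v * s v = seasonMean s t := by
  have hval : ((t : ZMod T) - 1).val = (t - 1) % T := by
    rw [← ZMod.val_natCast, Nat.cast_sub ht, Nat.cast_one]
  have hind (v : Fin T) :
      seasonInd T t v = if v = ⟨((t : ZMod T) - 1).val, ZMod.val_lt _⟩ then 1 else 0 := by
    simp [seasonInd, season_eq T ht, Fin.ext_iff, hval, eq_comm]
  simp [hind, seasonMean]

lemma sum_seasonMean_sq (s : Fin T → ℝ) : ∑ u, seasonMean s u ^ 2 = ∑ v, s v ^ 2 := by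
  have hinj : Function.Injective fun u : ZMod T => (⟨(u - 1).val, ZMod.val_lt _⟩ : Fin T) :=
    fun u w h => sub_left_injective (ZMod.val_injective T (Fin.mk.inj_iff.1 h))
  exact ((Fintype.bijective_iff_injective_and_card _).2 ⟨hinj, by simp [ZMod.card]⟩).sum_comp
    fun v => s v ^ 2

lemma sum_range_natCast_zmod (g : ZMod T → ℝ) :
    ∑ k ∈ Finset.range T, g (k : ZMod T) = ∑ u, g u := by
  have hinj : Function.Injective fun k : Fin T => ((k : ℕ) : ZMod T) := fun k k' h => by
    simpa [Fin.ext_iff, ZMod.val_natCast, Nat.mod_eq_of_lt] using congrArg ZMod.val h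
  rw [Finset.sum_range]
  exact ((Fintype.bijective_iff_injective_and_card _).2 ⟨hinj, by simp [ZMod.card]⟩).sum_comp g

lemma sum_Ico_natCast_zmod (g : ZMod T → ℝ) (A q : ℕ) :
    ∑ t ∈ Finset.Ico A (A + q * T), g (t : ZMod T) = q * ∑ u, g u := by
  induction q with
  | zero => simp
  | succ q ih =>
    have hperiod : ∑ t ∈ Finset.Ico (A + q * T) (A + q * T + T), g (t : ZMod T) = ∑ u, g u := by
      rw [Finset.sum_Ico_eq_sum_range, Nat.add_sub_cancel_left,
        ← Equiv.sum_comp (Equiv.addLeft ((A + q * T : ℕ) : ZMod T)) g, ← sum_range_natCast_zmod]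
      simp
    rw [← Finset.sum_Ico_consecutive _ (Nat.le_add_right A (q * T)) (by gcongr; omega), ih,
      Nat.succ_mul, ← add_assoc, hperiod]
    push_cast
    ring

variable {l : RelConfig} {N : ℕ}

lemma regimeInd_eq_ite (hmono : Monotone (l.tau N)) {r t : ℕ} (ht : l.tau N r ≤ t)
    (ht' : t < l.tau N (r + 1)) (q : Fin l.m) :
    regimeInd l N t q = if (q : ℕ) + 1 = r then 1 else 0 := by
  unfold regimeInd
  refine if_congr ⟨fun ⟨h₁, h₂⟩ => ?_, fun h => by subst h; exact ⟨ht, ht'⟩⟩ rfl rfl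
  have h₁ := hmono.reflect_lt (h₁.trans_lt ht')
  have h₂ := hmono.reflect_lt (ht.trans_lt h₂)
  omega

lemma fitted_eq_of_mem_regime (hmono : Monotone (l.tau N)) (s : Fin T → ℝ) (μ : Fin l.m → ℝ)
    {r t : ℕ} (ht : l.tau N r ≤ t) (ht' : t < l.tau N (r + 1)) :
    fitted T l N s μ t = seasonMean s t + regimeMean l μ r := by
  have ht₁ : 1 ≤ t := l.tau_zero N ▸ (hmono (Nat.zero_le r)).trans ht
  rw [fitted, sum_seasonInd_mul s ht₁]
  simp only [regimeInd_eq_ite hmono ht ht', ite_mul, one_mul, zero_mul]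
  rcases r with _ | r
  · simp [regimeMean]
  · by_cases h : r < l.m
    · have (q : Fin l.m) : (q : ℕ) = r ↔ q = ⟨r, h⟩ := by rw [Fin.ext_iff]
      simp [regimeMean, h, this]
    · have (q : Fin l.m) : (q : ℕ) ≠ r := by omega
      simp [regimeMean, h, this]

/-! ### Lower bound for filtered mean functions -/

lemma sum_sq_add_sum_sq_le (s : Fin T → ℝ) (μ : Fin l.m → ℝ) :
    ∑ v, s v ^ 2 + ∑ r, μ r ^ 2 ≤ 2 * (l.m + 1) *
      ∑ r ∈ Finset.range (l.m + 1), ∑ u, (seasonMean s u + regimeMean l μ r) ^ 2 := by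
  have hμ (r : Fin l.m) : μ r ^ 2 ≤
      2 * ∑ u, (seasonMean s u + μ r) ^ 2 + 2 * ∑ v, s v ^ 2 := by
    rw [← sum_seasonMean_sq, Finset.mul_sum, Finset.mul_sum, ← Finset.sum_add_distrib]
    refine le_trans ?_ (Finset.single_le_sum (f := fun u : ZMod T =>
      2 * (seasonMean s u + μ r) ^ 2 + 2 * seasonMean s u ^ 2)
      (fun _ _ => by positivity) (Finset.mem_univ 0))
    nlinarith [sq_nonneg (2 * seasonMean s 0 + μ r)]
  have hsum := Finset.sum_le_sum fun r (_ : r ∈ Finset.univ) => hμ r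
  simp only [Finset.sum_add_distrib, ← Finset.mul_sum, Finset.sum_const, Finset.card_univ,
    Fintype.card_fin, nsmul_eq_mul] at hsum
  rw [Finset.sum_range_succ', Finset.sum_range]
  simp only [regimeMean, Fin.is_lt, dite_true, Fin.eta, add_zero, sum_seasonMean_sq]
  have hS : 0 ≤ ∑ v, s v ^ 2 := Finset.sum_nonneg fun _ _ => sq_nonneg _
  have hR : 0 ≤ (l.m : ℝ) * ∑ r, ∑ u, (seasonMean s u + μ r) ^ 2 := by positivity
  linarith

variable {p q r : ℕ} {c : ℕ → ℝ} {K : ℝ}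

lemma mul_sum_sq_le_sum_lagSum_fitted_sq (hmono : Monotone (l.tau N)) (hK : 0 ≤ K)
    (hc : ∀ f : ZMod T → ℝ,
      ∑ u, f u ^ 2 ≤ K * ∑ u : ZMod T, (∑ i ∈ Finset.range (p + 1), c i * f (u - i)) ^ 2)
    (s : Fin T → ℝ) (μ : Fin l.m → ℝ) (hr : r ≤ l.m)
    (hq : l.tau N r + p + q * T ≤ l.tau N (r + 1)) :
    q * ∑ u, (seasonMean s u + regimeMean l μ r) ^ 2
      ≤ K * ∑ t ∈ Finset.Icc (p + 1) N, lagSum p c (fitted T l N s μ) t ^ 2 := by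
  let f (u : ZMod T) : ℝ := seasonMean s u + regimeMean l μ r
  have hτ : 1 ≤ l.tau N r := l.tau_zero N ▸ hmono (Nat.zero_le r)
  have hτ' : l.tau N (r + 1) ≤ N + 1 := l.tau_of_lt N (Nat.lt_succ_self _) ▸ hmono (by omega)
  calc q * ∑ u, f u ^ 2
      ≤ q * (K * ∑ u : ZMod T, (∑ i ∈ Finset.range (p + 1), c i * f (u - i)) ^ 2) := by
        gcongr; exact hc f
    _ = K * ∑ t ∈ Finset.Ico (l.tau N r + p) (l.tau N r + p + q * T),
          (∑ i ∈ Finset.range (p + 1), c i * f ((t : ZMod T) - i)) ^ 2 := by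
        rw [sum_Ico_natCast_zmod
          (fun u : ZMod T => (∑ i ∈ Finset.range (p + 1), c i * f (u - i)) ^ 2)]
        ring
    _ = K * ∑ t ∈ Finset.Ico (l.tau N r + p) (l.tau N r + p + q * T),
          lagSum p c (fitted T l N s μ) t ^ 2 := by
        refine congrArg (K * ·) (Finset.sum_congr rfl fun t ht => congrArg (· ^ 2) ?_)
        refine Finset.sum_congr rfl fun i hi => ?_
        have ht := Finset.mem_Ico.1 ht
        have hi := Finset.mem_range.1 hi
        rw [fitted_eq_of_mem_regime hmono s μ (t := t - i) (r := r) (by omega) (by omega),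
          Nat.cast_sub (by omega)]
    _ ≤ _ := by
        refine mul_le_mul_of_nonneg_left (Finset.sum_le_sum_of_subset_of_nonneg
          (fun t ht => ?_) fun _ _ _ => sq_nonneg _) hK
        simp only [Finset.mem_Ico, Finset.mem_Icc] at ht ⊢
        omega

theorem exists_mul_sum_sq_le_sum_lagSum_fitted_sq (p T : ℕ) [NeZero T] (l : RelConfig) :
    ∃ ρ : ℝ, 0 < ρ ∧ ∀ᶠ N : ℕ in atTop, ∀ (c : ℕ → ℝ) (K : ℝ), 0 ≤ K →
      (∀ f : ZMod T → ℝ,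
        ∑ u, f u ^ 2 ≤ K * ∑ u : ZMod T, (∑ i ∈ Finset.range (p + 1), c i * f (u - i)) ^ 2) →
      ∀ (s : Fin T → ℝ) (μ : Fin l.m → ℝ),
        ρ * N * (∑ v, s v ^ 2 + ∑ r, μ r ^ 2)
          ≤ K * ∑ t ∈ Finset.Icc (p + 1) N, lagSum p c (fitted T l N s μ) t ^ 2 := by
  obtain ⟨d, hd, hper⟩ := l.exists_mul_le_periods p (NeZero.pos T)
  refine ⟨d / (2 * (l.m + 1) * (l.m + 1)), by positivity, ?_⟩
  filter_upwards [hper, l.eventually_monotone_tau] with N hper hmono c K hK hc s μ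
  have hreg (r : ℕ) (hr : r ∈ Finset.range (l.m + 1)) :
      d * N * ∑ u, (seasonMean s u + regimeMean l μ r) ^ 2
        ≤ K * ∑ t ∈ Finset.Icc (p + 1) N, lagSum p c (fitted T l N s μ) t ^ 2 := by
    have hr := Finset.mem_range_succ_iff.1 hr
    obtain ⟨q, hdq, hq⟩ := hper r hr
    refine le_trans ?_ (mul_sum_sq_le_sum_lagSum_fitted_sq hmono hK hc s μ hr hq)
    gcongr
  have hsum := Finset.sum_le_sum hreg
  simp only [← Finset.mul_sum, Finset.sum_const, Finset.card_range, nsmul_eq_mul] at hsum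
  push_cast at hsum
  calc _ ≤ d / (2 * (l.m + 1) * (l.m + 1)) * N * (2 * (l.m + 1) *
          ∑ r ∈ Finset.range (l.m + 1), ∑ u, (seasonMean s u + regimeMean l μ r) ^ 2) := by
        gcongr; exact sum_sq_add_sum_sq_le s μ
    _ = (d * N * ∑ r ∈ Finset.range (l.m + 1),
          ∑ u, (seasonMean s u + regimeMean l μ r) ^ 2) / (l.m + 1) := by field_simp
    _ ≤ _ := by
        rw [div_le_iff₀ (by positivity)]
        linarith

end Season

/-! ### Logarithms and determinants -/

lemma abs_log_sub_log_le {a b α β : ℝ} (hb : 0 < b) (hα : 0 < α) (h₁ : α * b ≤ a)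
    (h₂ : a ≤ β * b) : |Real.log a - Real.log b| ≤ |Real.log α| + |Real.log β| := by
  have hab : α ≤ a / b := (le_div_iff₀ hb).2 h₁
  have hab' : a / b ≤ β := (div_le_iff₀ hb).2 h₂
  rw [← Real.log_div ((mul_pos hα hb).trans_le h₁).ne' hb.ne', abs_le]
  have hlow := Real.log_le_log hα hab
  have hup := Real.log_le_log (hα.trans_le hab) hab'
  constructor
  · linarith [neg_abs_le (Real.log α), abs_nonneg (Real.log β)]
  · linarith [le_abs_self (Real.log β), abs_nonneg (Real.log α)]

lemma abs_log_sub_log_le_div {Q R K : ℝ} (hR : 0 < R) (hRQ : R ≤ Q) (hQ : Q ≤ R + K) :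
    |Real.log Q - Real.log R| ≤ K / R := by
  rw [abs_of_nonneg (sub_nonneg.2 (Real.log_le_log hR hRQ)),
    ← Real.log_div (hR.trans_le hRQ).ne' hR.ne']
  calc Real.log (Q / R) ≤ Q / R - 1 := Real.log_le_sub_one_of_pos (div_pos (hR.trans_le hRQ) hR)
    _ = (Q - R) / R := div_sub_one hR.ne'
    _ ≤ K / R := by gcongr; linarith

lemma exists_abs_sum_log_regimeLen_sub_le (l : RelConfig) :
    ∃ K : ℝ, ∀ᶠ N : ℕ in atTop,
      |∑ r ∈ Finset.Icc 2 (l.m + 1), Real.log (l.regimeLen N r) - l.m * Real.log N| ≤ K := by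
  obtain ⟨d, hd, hgap⟩ := l.exists_le_ext_sub
  refine ⟨l.m * (|Real.log (d / 2)| + |Real.log 1|), ?_⟩
  filter_upwards [eventually_gt_atTop 0, (tendsto_natCast_atTop_atTop.const_mul_atTop
    hd).eventually_ge_atTop 2] with N hN hNd
  have hN' : (0 : ℝ) < N := by exact_mod_cast hN
  have hterm (r : ℕ) (hr : r ∈ Finset.Icc 2 (l.m + 1)) :
      |Real.log (l.regimeLen N r) - Real.log N| ≤ |Real.log (d / 2)| + |Real.log 1| := by
    obtain ⟨hr₂, hrm⟩ := Finset.mem_Icc.1 hr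
    obtain ⟨k, rfl⟩ := Nat.exists_eq_add_of_le' (show 1 ≤ r by omega)
    have hk := mul_le_mul_of_nonneg_right (hgap k (by omega)) hN'.le
    have hfloor := Nat.sub_one_lt_floor (l.ext (k + 1) * N)
    have hfloor' := Nat.floor_le (mul_nonneg (l.ext_nonneg k) hN'.le)
    have hle := Nat.floor_le (mul_nonneg (l.ext_nonneg (k + 1)) hN'.le)
    have hone := mul_le_mul_of_nonneg_right (l.ext_le_one (k + 1)) hN'.le
    have : (0 : ℝ) ≤ (⌊l.ext k * N⌋₊ : ℝ) := Nat.cast_nonneg _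
    refine abs_log_sub_log_le hN' (by positivity) ?_ ?_ <;>
      rw [RelConfig.regimeLen, Nat.add_sub_cancel] <;> linarith
  calc _ = |∑ r ∈ Finset.Icc 2 (l.m + 1), (Real.log (l.regimeLen N r) - Real.log N)| := by
        simp [Finset.sum_sub_distrib]
    _ ≤ ∑ r ∈ Finset.Icc 2 (l.m + 1), |Real.log (l.regimeLen N r) - Real.log N| :=
        Finset.abs_sum_le_sum_abs _ _
    _ ≤ _ := (Finset.sum_le_sum hterm).trans_eq (by simp)

section Determinant

variable {ι : Type*} [Fintype ι] [DecidableEq ι] {S : Matrix ι ι ℝ} {α β : ℝ}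

lemma eigenvalues_mem_Icc (hS : S.IsHermitian) (h₁ : ∀ u, α * (u ⬝ᵥ u) ≤ u ⬝ᵥ (S *ᵥ u))
    (h₂ : ∀ u, u ⬝ᵥ (S *ᵥ u) ≤ β * (u ⬝ᵥ u)) (i : ι) : hS.eigenvalues i ∈ Set.Icc α β := by
  let e : ι → ℝ := hS.eigenvectorBasis i
  have hunit : e ⬝ᵥ e = 1 := by
    have := EuclideanSpace.real_norm_sq_eq (hS.eigenvectorBasis i)
    rw [hS.eigenvectorBasis.orthonormal.1 i, one_pow] at this
    simpa [e, dotProduct, ← sq] using this.symm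
  have hval : e ⬝ᵥ (S *ᵥ e) = hS.eigenvalues i := by
    rw [show S *ᵥ e = hS.eigenvalues i • e from hS.mulVec_eigenvectorBasis i, dotProduct_smul,
      hunit, smul_eq_mul, mul_one]
  simpa [hunit, hval] using And.intro (h₁ e) (h₂ e)

lemma det_mem_Icc (hS : S.IsHermitian) (hα : 0 ≤ α)
    (h₁ : ∀ u, α * (u ⬝ᵥ u) ≤ u ⬝ᵥ (S *ᵥ u)) (h₂ : ∀ u, u ⬝ᵥ (S *ᵥ u) ≤ β * (u ⬝ᵥ u)) :
    S.det ∈ Set.Icc (α ^ Fintype.card ι) (β ^ Fintype.card ι) := by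
  have hev := eigenvalues_mem_Icc hS h₁ h₂
  have hdet : S.det = ∏ i, hS.eigenvalues i := by simpa using hS.det_eq_prod_eigenvalues
  rw [hdet, Fintype.card, ← Finset.prod_const, ← Finset.prod_const]
  exact ⟨Finset.prod_le_prod (fun _ _ => hα) fun i _ => (hev i).1,
    Finset.prod_le_prod (fun i _ => hα.trans (hev i).1) fun i _ => (hev i).2⟩

end Determinant

/-! ### The filtered regression -/

section FilteredRegression

variable {p T : ℕ} {l : RelConfig} {N : ℕ} {x : ℕ → ℝ} {κ G ν : ℝ}

lemma sum_fin_sub_eq_sum_Icc (p N : ℕ) (f : ℕ → ℝ) :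
    ∑ k : Fin (N - p), f (p + 1 + k) = ∑ t ∈ Finset.Icc (p + 1) N, f t := by
  rw [← Finset.sum_range (fun k => f (p + 1 + k)), ← Finset.Ico_add_one_right_eq_Icc,
    Finset.sum_Ico_eq_sum_range, Nat.add_sub_add_right]

lemma hat_mulVec_add_hat_mulVec (s : Fin T → ℝ) (u : Fin l.m → ℝ) (k : Fin (N - p)) :
    (AHat p T l N x *ᵥ s) k + (DHat p T l N x *ᵥ u) k
      = lagSum p (arCoeff (phiHat p T l N x)) (fitted T l N s u) (p + 1 + k) := by
  simp only [lagSum, fitted, AHat, DHat, mulVec, dotProduct, Matrix.of_apply, arFilter_eq_lagSum,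
    mul_add, Finset.sum_add_distrib, Finset.mul_sum, Finset.sum_mul, mul_assoc]
  rw [Finset.sum_comm, Finset.sum_comm (s := (Finset.univ : Finset (Fin l.m)))]

lemma hat_mulVec_dotProduct_self (s : Fin T → ℝ) (u : Fin l.m → ℝ) :
    (AHat p T l N x *ᵥ s + DHat p T l N x *ᵥ u) ⬝ᵥ (AHat p T l N x *ᵥ s + DHat p T l N x *ᵥ u)
      = ∑ t ∈ Finset.Icc (p + 1) N,
        lagSum p (arCoeff (phiHat p T l N x)) (fitted T l N s u) t ^ 2 := by
  rw [← sum_fin_sub_eq_sum_Icc p N]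
  simp only [dotProduct, Pi.add_apply, hat_mulVec_add_hat_mulVec, ← sq]

lemma hat_resid_dotProduct_self (s : Fin T → ℝ) (u : Fin l.m → ℝ) :
    (XHat p T l N x - AHat p T l N x *ᵥ s - DHat p T l N x *ᵥ u) ⬝ᵥ
        (XHat p T l N x - AHat p T l N x *ᵥ s - DHat p T l N x *ᵥ u)
      = ∑ t ∈ Finset.Icc (p + 1) N,
        lagSum p (arCoeff (phiHat p T l N x)) (fun t => x t - fitted T l N s u t) t ^ 2 := by
  rw [← sum_fin_sub_eq_sum_Icc p N]
  simp only [dotProduct, Pi.sub_apply, sub_sub, hat_mulVec_add_hat_mulVec, ← sq]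
  simp [XHat, arFilter_eq_lagSum, lagSum, mul_sub]

lemma sum_fitted_zero_sq_le (u : Fin l.m → ℝ) :
    ∑ t ∈ Finset.Icc 1 N, fitted T l N 0 u t ^ 2 ≤ N * (l.m * (u ⬝ᵥ u)) := by
  have hterm (t : ℕ) : fitted T l N 0 u t ^ 2 ≤ l.m * (u ⬝ᵥ u) :=
    calc fitted T l N 0 u t ^ 2 = (∑ r, regimeInd l N t r * u r) ^ 2 := by simp [fitted]
      _ ≤ (∑ r, regimeInd l N t r ^ 2) * ∑ r, u r ^ 2 := Finset.sum_mul_sq_le_sq_mul_sq _ _ _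
      _ ≤ (∑ _r : Fin l.m, 1) * ∑ r, u r ^ 2 := by
          gcongr with r
          unfold regimeInd
          split_ifs <;> norm_num
      _ = l.m * (u ⬝ᵥ u) := by simp [dotProduct, sq]
  exact (Finset.sum_le_sum fun t _ => hterm t).trans_eq (by simp)

namespace GoodSample

lemma sum_lagSum_sq_le (h : GoodSample p T l N x κ G) (hN : 0 < N) (hκ : 0 < κ) (f : ℕ → ℝ) :
    ∑ t ∈ Finset.Icc (p + 1) N, lagSum p (arCoeff (phiHat p T l N x)) f t ^ 2
      ≤ G / κ * ((p + 1) * ∑ t ∈ Finset.Icc 1 N, f t ^ 2) := by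
  have hlag := Changepoint.sum_lagSum_sq_le p (arCoeff (phiHat p T l N x)) f 0 N
  simp only [zero_add] at hlag
  refine hlag.trans ?_
  gcongr
  exact h.sum_arCoeff_sq_le hN hκ

lemma XHat_dotProduct_self_le (h : GoodSample p T l N x κ G) (hN : 0 < N) (hκ : 0 < κ)
    (hG : 0 ≤ G) : XHat p T l N x ⬝ᵥ XHat p T l N x ≤ G / κ * ((p + 1) * (G * N)) := by
  have hX := hat_resid_dotProduct_self (p := p) (l := l) (N := N) (x := x) (0 : Fin T → ℝ) 0
  simp only [mulVec_zero, sub_zero, fitted, Pi.zero_apply, mul_zero, Finset.sum_const_zero,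
    add_zero] at hX
  rw [hX]
  refine (h.sum_lagSum_sq_le hN hκ x).trans ?_
  gcongr
  exact h.upper

lemma le_hat_resid_dotProduct_self (h : GoodSample p T l N x κ G) (hκ : 0 ≤ κ) (s : Fin T → ℝ)
    (u : Fin l.m → ℝ) :
    κ * N ≤ (XHat p T l N x - AHat p T l N x *ᵥ s - DHat p T l N x *ᵥ u) ⬝ᵥ
      (XHat p T l N x - AHat p T l N x *ᵥ s - DHat p T l N x *ᵥ u) := by
  rw [hat_resid_dotProduct_self]
  have hone : (1 : ℝ) ≤ ∑ i ∈ Finset.range (p + 1), arCoeff (phiHat p T l N x) i ^ 2 :=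
    (one_pow 2).symm.le.trans (Finset.single_le_sum
      (f := fun i => arCoeff (phiHat p T l N x) i ^ 2) (fun _ _ => sq_nonneg _)
      (Finset.mem_range.2 p.succ_pos))
  exact (le_mul_of_one_le_right (by positivity) hone).trans (h.lower _ s u)

end GoodSample

lemma exists_le_hat_mulVec_dotProduct_self (p T : ℕ) [NeZero T] (l : RelConfig) (hκ : 0 < κ)
    (hG : 0 ≤ G) :
    ∃ ρ : ℝ, 0 < ρ ∧ ∀ᶠ N : ℕ in atTop, ∀ x, GoodSample p T l N x κ G →
      ∀ (s : Fin T → ℝ) (u : Fin l.m → ℝ), ρ * N * (s ⬝ᵥ s + u ⬝ᵥ u) ≤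
        (AHat p T l N x *ᵥ s + DHat p T l N x *ᵥ u) ⬝ᵥ
          (AHat p T l N x *ᵥ s + DHat p T l N x *ᵥ u) := by
  obtain ⟨ρ, hρ, hdesign⟩ := exists_mul_sum_sq_le_sum_lagSum_fitted_sq p T l
  have hK := stabilityConst_nonneg (p := p) T (div_nonneg hG hκ.le)
  refine ⟨ρ / (stabilityConst p (G / κ) T + 1), by positivity, ?_⟩
  filter_upwards [hdesign, eventually_gt_atTop 0] with N hdesign hN x hx s u
  have hlow := hdesign _ _ hK (fun f => hx.sum_sq_le_yuleWalker_filter hN hκ f) s u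
  rw [← hat_mulVec_dotProduct_self] at hlow
  rw [div_mul_eq_mul_div, div_mul_eq_mul_div, div_le_iff₀' (by positivity)]
  have hsq := dotProduct_self_star_nonneg (AHat p T l N x *ᵥ s + DHat p T l N x *ᵥ u)
  rw [star_trivial] at hsq
  simp only [dotProduct, ← sq] at hlow hsq ⊢
  linarith

end FilteredRegression

/-! ### Comparison of the two criteria on good samples -/

section Penalised

variable {n : ℕ} {k m : Type*} [Fintype k] [Fintype m]

lemma mulVec_injective_of_le {A : Matrix (Fin n) k ℝ} {c : ℝ} (hc : 0 < c)
    (h : ∀ s, c * (s ⬝ᵥ s) ≤ (A *ᵥ s) ⬝ᵥ (A *ᵥ s)) : Function.Injective A.mulVec := by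
  refine (injective_iff_map_eq_zero A.mulVecLin).2 fun s hs => ?_
  have hs₀ := h s
  rw [show A *ᵥ s = 0 from hs, dotProduct_zero] at hs₀
  exact dotProduct_self_eq_zero.1 (le_antisymm (nonpos_of_mul_nonpos_right hs₀ hc)
    (dotProduct_self_star_nonneg s))

lemma isLeast_dotProduct_projResid_fromCols (A : Matrix (Fin n) k ℝ) (D : Matrix (Fin n) m ℝ)
    (x : Fin n → ℝ) :
    IsLeast (Set.range fun w : (k → ℝ) × (m → ℝ) =>
      (x - A *ᵥ w.1 - D *ᵥ w.2) ⬝ᵥ (x - A *ᵥ w.1 - D *ᵥ w.2))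
      (x ⬝ᵥ projResid (Matrix.fromCols A D) x) := by
  convert isLeast_dotProduct_projResid (Matrix.fromCols A D) x using 1
  rw [← (Equiv.sumArrowEquivProdArrow k m ℝ).surjective.range_comp]
  simp [Function.comp_def, Equiv.sumArrowEquivProdArrow, Matrix.fromCols_mulVec, sub_sub]

lemma dotProduct_self_le_of_sub {x y : Fin n → ℝ} {R : ℝ}
    (hx : x ⬝ᵥ x ≤ R) (hxy : (x - y) ⬝ᵥ (x - y) ≤ R) : y ⬝ᵥ y ≤ 4 * R := by
  have hsum : y ⬝ᵥ y ≤ 2 * (x ⬝ᵥ x) + 2 * ((x - y) ⬝ᵥ (x - y)) := by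
    simp only [dotProduct, Finset.mul_sum, ← Finset.sum_add_distrib, Pi.sub_apply]
    refine Finset.sum_le_sum fun k _ => ?_
    nlinarith [sq_nonneg (x k + (x k - y k))]
  linarith

variable [DecidableEq k] [DecidableEq m]

theorem gls_ridgeResid_mem_Icc {A : Matrix (Fin n) k ℝ} {D : Matrix (Fin n) m ℝ} {c ν : ℝ}
    (hc : 0 < c) (hν : 0 < ν)
    (hcoer : ∀ s u, c * (s ⬝ᵥ s + u ⬝ᵥ u) ≤ (A *ᵥ s + D *ᵥ u) ⬝ᵥ (A *ᵥ s + D *ᵥ u))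
    (x : Fin n → ℝ) :
    x ⬝ᵥ ((ridgeResid D ν - ridgeResid D ν * A * (Aᵀ * ridgeResid D ν * A)⁻¹ * Aᵀ *
        ridgeResid D ν) *ᵥ x)
      ∈ Set.Icc (x ⬝ᵥ projResid (Matrix.fromCols A D) x)
        (x ⬝ᵥ projResid (Matrix.fromCols A D) x + ν⁻¹ * (4 * (x ⬝ᵥ x) / c)) := by
  have hA : Function.Injective A.mulVec :=
    mulVec_injective_of_le hc fun s => by simpa using hcoer s 0
  obtain ⟨⟨⟨s₀, u₀⟩, hR⟩, hplain⟩ := isLeast_dotProduct_projResid_fromCols A D x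
  obtain ⟨⟨⟨s, u⟩, hQ⟩, hpen⟩ := isLeast_gls_ridgeResid hA D hν x
  refine ⟨?_, (hpen ⟨(s₀, u₀), rfl⟩).trans ?_⟩
  · rw [← hQ]
    exact (hplain ⟨(s, u), rfl⟩).trans
      (le_add_of_nonneg_right (mul_nonneg (inv_pos.2 hν).le (dotProduct_self_star_nonneg u)))
  · have hRx := hplain ⟨(0, 0), rfl⟩
    simp only [mulVec_zero, sub_zero, ← hR] at hRx
    have hfit := (hcoer s₀ u₀).trans
      (dotProduct_self_le_of_sub le_rfl (by rw [← sub_sub]; exact hRx))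
    have hu : u₀ ⬝ᵥ u₀ ≤ 4 * (x ⬝ᵥ x) / c :=
      (le_div_iff₀' hc).2 ((mul_le_mul_of_nonneg_left
        (le_add_of_nonneg_left (dotProduct_self_star_nonneg s₀)) hc.le).trans hfit)
    have := (inv_pos.2 hν).le
    rw [← hR]
    dsimp only
    gcongr

end Penalised

lemma GoodSample.le_dotProduct_projResid {p T : ℕ} {l : RelConfig} {N : ℕ} {x : ℕ → ℝ} {κ G : ℝ}
    (h : GoodSample p T l N x κ G) (hκ : 0 ≤ κ) :
    κ * N ≤ XHat p T l N x ⬝ᵥ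
      projResid (Matrix.fromCols (AHat p T l N x) (DHat p T l N x)) (XHat p T l N x) := by
  obtain ⟨⟨w, hw⟩, -⟩ :=
    isLeast_dotProduct_projResid_fromCols (AHat p T l N x) (DHat p T l N x) (XHat p T l N x)
  exact hw ▸ h.le_hat_resid_dotProduct_self hκ w.1 w.2

section Comparison

variable (p T : ℕ) [NeZero T] (l : RelConfig) {κ G ν : ℝ}

theorem exists_abs_log_sigmaSqHat_sub_le (hκ : 0 < κ) (hG : 0 ≤ G) (hν : 0 < ν) :
    ∃ K : ℝ, ∀ᶠ N : ℕ in atTop, ∀ x, GoodSample p T l N x κ G →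
      |((N : ℝ) - p) / 2 * Real.log (sigmaSqHat p T ν l N x)
        - ((N : ℝ) - p) / 2 * Real.log (sigmaSqHatInf p T l N x)| ≤ K := by
  obtain ⟨ρ, hρ, hdesign⟩ := exists_le_hat_mulVec_dotProduct_self p T l hκ hG
  let K := ν⁻¹ * (4 * (G / κ * ((p + 1) * G)) / ρ)
  have : 0 ≤ K := by positivity
  refine ⟨K / κ / 2, ?_⟩
  filter_upwards [hdesign, eventually_gt_atTop p] with N hdesign hNp x hx
  have hN : 0 < N := by omega
  have hN' : (0 : ℝ) < N := by exact_mod_cast hN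
  have hn : (0 : ℝ) < N - p := sub_pos.2 (by exact_mod_cast hNp)
  have hR := hx.le_dotProduct_projResid hκ.le
  have hRpos := (mul_pos hκ hN').trans_le hR
  obtain ⟨hRQ, hQR⟩ := gls_ridgeResid_mem_Icc (mul_pos hρ hN') hν (hdesign x hx) (XHat p T l N x)
  have hXK : ν⁻¹ * (4 * (XHat p T l N x ⬝ᵥ XHat p T l N x) / (ρ * N)) ≤ K := by
    calc _ ≤ ν⁻¹ * (4 * (G / κ * ((p + 1) * (G * N))) / (ρ * N)) := by
          gcongr
          exact hx.XHat_dotProduct_self_le hN hκ hG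
      _ = K := by simp only [K]; field_simp
  have hlog := abs_log_sub_log_le_div hRpos hRQ (hQR.trans (by gcongr))
  have hB : BHat p T ν l N x = ridgeResid (DHat p T l N x) ν := rfl
  rw [sigmaSqHat, sigmaSqHatInf, hB, ← mul_sub, Real.log_mul (inv_pos.2 hn).ne' hRpos.ne',
    Real.log_mul (inv_pos.2 hn).ne' (hRpos.trans_le hRQ).ne', add_sub_add_left_eq_sub, abs_mul,
    abs_of_pos (half_pos hn)]
  calc _ ≤ (N : ℝ) / 2 * (K / (κ * N)) := by
        refine mul_le_mul ?_ (hlog.trans ?_) (abs_nonneg _) (by positivity)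
        · linarith [p.cast_nonneg (α := ℝ)]
        · gcongr
    _ = K / κ / 2 := by field_simp

theorem exists_abs_log_det_ridgeGram_sub_le (hκ : 0 < κ) (hG : 0 ≤ G) (hν : 0 < ν) :
    ∃ K : ℝ, ∀ᶠ N : ℕ in atTop, ∀ x, GoodSample p T l N x κ G →
      |Real.log (ridgeGram p T ν l N x).det - l.m * Real.log N| ≤ K := by
  obtain ⟨ρ, hρ, hdesign⟩ := exists_le_hat_mulVec_dotProduct_self p T l hκ hG
  let β := G / κ * ((p + 1) * l.m) + ν⁻¹
  refine ⟨|Real.log (ρ ^ l.m)| + |Real.log (β ^ l.m)|, ?_⟩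
  filter_upwards [hdesign, eventually_gt_atTop 0] with N hdesign hN x hx
  have : (0 : ℝ) < N := by exact_mod_cast hN
  have hN₁ : (1 : ℝ) ≤ N := by exact_mod_cast hN
  have hν' := inv_pos.2 hν
  have hself (u : Fin l.m → ℝ) : 0 ≤ u ⬝ᵥ u := dotProduct_self_star_nonneg u
  have hlow (u : Fin l.m → ℝ) : ρ * N * (u ⬝ᵥ u) ≤ u ⬝ᵥ (ridge (DHat p T l N x) ν *ᵥ u) := by
    rw [dotProduct_ridge]
    have hD := hdesign x hx 0 u
    rw [mulVec_zero, zero_add, dotProduct_zero, zero_add] at hD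
    exact hD.trans (le_add_of_nonneg_right (mul_nonneg hν'.le (hself u)))
  have hup (u : Fin l.m → ℝ) : u ⬝ᵥ (ridge (DHat p T l N x) ν *ᵥ u) ≤ β * N * (u ⬝ᵥ u) := by
    have hD := hat_mulVec_dotProduct_self (p := p) (N := N) (x := x) (0 : Fin T → ℝ) u
    rw [mulVec_zero, zero_add] at hD
    rw [dotProduct_ridge, hD]
    calc _ ≤ G / κ * ((p + 1) * (N * (l.m * (u ⬝ᵥ u)))) + ν⁻¹ * N * (u ⬝ᵥ u) := by
          refine add_le_add ((hx.sum_lagSum_sq_le hN hκ _).trans ?_)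
            (mul_le_mul_of_nonneg_right (le_mul_of_one_le_right hν'.le hN₁) (hself u))
          gcongr
          exact sum_fitted_zero_sq_le u
      _ = β * N * (u ⬝ᵥ u) := by ring
  obtain ⟨h₁, h₂⟩ := det_mem_Icc (ridge_posDef (DHat p T l N x) hν).isHermitian
    (by positivity) hlow hup
  rw [Fintype.card_fin, mul_pow] at h₁ h₂
  rw [← Real.log_pow]
  exact abs_log_sub_log_le (by positivity) (by positivity) h₁ h₂

end Comparison

/-! ### Prior terms -/

lemma isBigO_log_sub_log_of_isTheta {u v : ℕ → ℝ} (h : u =Θ[atTop] v) :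
    (fun N => Real.log (u N) - Real.log (v N)) =O[atTop] fun _ => (1 : ℝ) := by
  obtain ⟨β, hβ⟩ := h.1.bound
  obtain ⟨α, hα, hα'⟩ := h.2.exists_pos
  refine .of_bound (|Real.log α⁻¹| + |Real.log β|) ?_
  filter_upwards [hβ, hα'.bound] with N h₁ h₂
  simp only [Real.norm_eq_abs] at h₁ h₂
  rw [Real.norm_eq_abs, norm_one, mul_one, ← Real.log_abs (u N), ← Real.log_abs (v N)]
  rcases eq_or_ne (v N) 0 with hv | hv
  · have hu : u N = 0 := by simpa [hv] using h₁
    rw [hu, hv, sub_self, abs_zero]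
    positivity
  · exact abs_log_sub_log_le (abs_pos.2 hv) (inv_pos.2 hα) ((inv_mul_le_iff₀ hα).2 h₂) h₁

lemma isBigO_one_of_le {F : ℕ → ℕ → ℝ} {m : ℕ} {k : ℕ → ℕ}
    (hF : ∀ j ≤ m, F j =O[atTop] fun _ => (1 : ℝ)) (hk : ∀ N, k N ≤ m) :
    (fun N => F (k N) N) =O[atTop] fun _ => (1 : ℝ) := by
  refine .trans (.of_norm_le fun N => ?_) (Asymptotics.IsBigO.fun_sum (s := Finset.range (m + 1))
    fun j hj => (hF j (Finset.mem_range_succ_iff.1 hj)).norm_left)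
  exact Finset.single_le_sum (f := fun j => ‖F j N‖) (fun _ _ => norm_nonneg _)
    (Finset.mem_range_succ_iff.2 (hk N))

lemma tendsto_natCast_of_isTheta {n : ℕ → ℕ}
    (hn : (fun N => (n N : ℝ)) =Θ[atTop] fun N : ℕ => (N : ℝ)) :
    Tendsto (fun N => (n N : ℝ)) atTop atTop := by
  simpa only [Function.comp_def, Real.norm_natCast] using
    hn.tendsto_norm_atTop_iff.2 (tendsto_norm_atTop_atTop.comp tendsto_natCast_atTop_atTop)

lemma isTheta_add_natCast_sub (b c : ℝ) {n : ℕ → ℕ}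
    (hn : (fun N => (n N : ℝ)) =Θ[atTop] fun N : ℕ => (N : ℝ)) :
    (fun N => b + n N - c) =Θ[atTop] fun N : ℕ => (N : ℝ) := by
  have hconst : (fun _ : ℕ => b - c) =o[atTop] fun N : ℕ => (N : ℝ) :=
    Asymptotics.isLittleO_const_left.2 (.inr (tendsto_norm_atTop_atTop.comp
      tendsto_natCast_atTop_atTop))
  refine EventuallyEq.trans_isTheta (.of_eq <| funext fun N => ?_) (hconst.add_isTheta hn)
  exact (sub_add_eq_add_sub _ _ _).symm

lemma isBigO_log_Gamma_sub_natCast (b : ℝ) {n : ℕ → ℕ} (k : ℕ)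
    (hn : (fun N => (n N : ℝ)) =Θ[atTop] fun N : ℕ => (N : ℝ)) :
    (fun N : ℕ => Real.log (Real.Gamma (b + n N - k)) - Real.log (Real.Gamma (b + n N))
      + k * Real.log N) =O[atTop] fun _ => (1 : ℝ) := by
  induction k with
  | zero => exact (Asymptotics.isBigO_zero _ _).congr_left fun N => by simp
  | succ k ih =>
    refine (ih.sub (isBigO_log_sub_log_of_isTheta
      (isTheta_add_natCast_sub b (k + 1 : ℕ) hn))).congr' ?_ .rfl
    filter_upwards [(tendsto_natCast_of_isTheta hn).eventually_gt_atTop ((k + 1 : ℕ) - b)]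
      with N hN
    have hpos : 0 < b + n N - (k + 1 : ℕ) := by linarith
    have hΓ : Real.Gamma (b + n N - k) =
        (b + n N - (k + 1 : ℕ)) * Real.Gamma (b + n N - (k + 1 : ℕ)) := by
      rw [← Real.Gamma_add_one hpos.ne']
      congr 1
      push_cast
      ring
    rw [hΓ, Real.log_mul hpos.ne' (Real.Gamma_pos_of_pos hpos).ne']
    push_cast
    ring

/-- The logarithm of the prior factor `Γ(a + k) Γ(b + n - k)` for `k` changepoints among `n`
possible times. -/
def logPrior (a b : ℝ) (n k : ℕ) : ℝ :=
  Real.log (Real.Gamma (a + k) * Real.Gamma (b + n - k))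

lemma isBigO_logPrior {a b : ℝ} (ha : 0 < a) (hb : 0 < b) {n k : ℕ → ℕ} {m : ℕ}
    (hk : ∀ N, k N ≤ m)
    (hn : ((fun N => (n N : ℝ)) =Θ[atTop] fun N : ℕ => (N : ℝ)) ∨ ∀ N, k N = 0) :
    (fun N => logPrior a b (n N) (k N) - Real.log (Real.Gamma (b + n N)) + k N * Real.log N)
      =O[atTop] fun _ => (1 : ℝ) := by
  have hpos : ∀ᶠ N in atTop, 0 < b + n N - k N := by
    rcases hn with hn | hk₀
    · filter_upwards [(tendsto_natCast_of_isTheta hn).eventually_ge_atTop m] with N hN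
      have hkm : (k N : ℝ) ≤ m := by exact_mod_cast hk N
      linarith
    · exact .of_forall fun N => by rw [hk₀, Nat.cast_zero, sub_zero]; positivity
  have hΓ : (fun N => Real.log (Real.Gamma (b + n N - k N)) - Real.log (Real.Gamma (b + n N))
      + k N * Real.log N) =O[atTop] fun _ => (1 : ℝ) := by
    rcases hn with hn | hk₀
    · exact isBigO_one_of_le (fun j _ => isBigO_log_Gamma_sub_natCast b j hn) hk
    · exact (Asymptotics.isBigO_zero _ _).congr_left fun N => by simp [hk₀]
  have hΓa : (fun N => Real.log (Real.Gamma (a + k N))) =O[atTop] fun _ => (1 : ℝ) :=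
    isBigO_one_of_le (F := fun j _ => Real.log (Real.Gamma (a + j)))
      (fun _ _ => Asymptotics.isBigO_const_const _ one_ne_zero _) hk
  refine (hΓa.add hΓ).congr' ?_ .rfl
  filter_upwards [hpos] with N hN
  rw [logPrior, Real.log_mul (Real.Gamma_pos_of_pos (by positivity)).ne'
    (Real.Gamma_pos_of_pos hN).ne']
  ring

lemma RelConfig.mUndoc_add_mDoc (l : RelConfig) (N : ℕ) (doc : Finset ℕ) :
    l.mUndoc N doc + l.mDoc N doc = l.m := by
  rw [add_comm, mUndoc, mDoc, Finset.card_filter_add_card_filter_not, Nat.card_Icc,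
    Nat.add_sub_cancel]

/-- The model-independent part of `BMDL - MDL`. The summand `-log N` is what remains of the MDL
penalty `(m + 1) log (N - p)` after the Gamma ratios have contributed `m log N`. -/
def normConst (p : ℕ) (b₁ b₂ : ℝ) (doc : ℕ → Finset ℕ) (N : ℕ) : ℝ :=
  -Real.log (Real.Gamma (b₁ + nUndoc p N (doc N)))
    - Real.log (Real.Gamma (b₂ + nDoc p N (doc N))) - Real.log N

theorem isBigO_prior_sub {p : ℕ} {a b₁ b₂ : ℝ} (ha : 0 < a) (hb₁ : 0 < b₁) (hb₂ : 0 < b₂)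
    {doc : ℕ → Finset ℕ}
    (hdoc : (∀ N, doc N = ∅) ∨
      (((fun N => (nUndoc p N (doc N) : ℝ)) =Θ[atTop] fun N : ℕ => (N : ℝ)) ∧
       ((fun N => (nDoc p N (doc N) : ℝ)) =Θ[atTop] fun N : ℕ => (N : ℝ)))) (l : RelConfig) :
    (fun N : ℕ => -(logPrior a b₁ (nUndoc p N (doc N)) (l.mUndoc N (doc N))
        + logPrior a b₂ (nDoc p N (doc N)) (l.mDoc N (doc N)))
      - ((l.m : ℝ) + 1) * Real.log ((N : ℝ) - p) - normConst p b₁ b₂ doc N)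
      =O[atTop] fun _ => (1 : ℝ) := by
  have hsub : (fun N : ℕ => (N : ℝ) - p) =Θ[atTop] fun N : ℕ => (N : ℝ) := by
    simpa using isTheta_add_natCast_sub 0 p (Asymptotics.isTheta_refl (fun N : ℕ => (N : ℝ)) _)
  have hundoc : (fun N => (nUndoc p N (doc N) : ℝ)) =Θ[atTop] fun N : ℕ => (N : ℝ) := by
    refine hdoc.elim (fun h => EventuallyEq.trans_isTheta ?_ hsub) And.left
    filter_upwards [eventually_ge_atTop p] with N hN
    simp [nUndoc, h N, hN]
  have hdoc' : ((fun N => (nDoc p N (doc N) : ℝ)) =Θ[atTop] fun N : ℕ => (N : ℝ)) ∨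
      ∀ N, l.mDoc N (doc N) = 0 :=
    hdoc.elim (fun h => .inr fun N => by simp [RelConfig.mDoc, h N]) fun h => .inl h.2
  have hm (N : ℕ) := l.mUndoc_add_mDoc N (doc N)
  refine (((isBigO_logPrior ha hb₁ (fun N => (hm N).le.trans' (Nat.le_add_right _ _))
    (.inl hundoc)).add (isBigO_logPrior ha hb₂ (fun N => (hm N).le.trans' (Nat.le_add_left _ _))
      hdoc')).neg_left.sub ((isBigO_log_sub_log_of_isTheta hsub).const_mul_left
        ((l.m : ℝ) + 1))).congr_left fun N => ?_
  have hm' : (l.mUndoc N (doc N) : ℝ) + l.mDoc N (doc N) = l.m := by exact_mod_cast hm N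
  rw [← hm', normConst]
  ring

theorem exists_abs_BMDL_sub_MDL_sub_normConst_le {p T : ℕ} [NeZero T] {ν a b₁ b₂ : ℝ}
    (hν : 0 < ν) (ha : 0 < a) (hb₁ : 0 < b₁) (hb₂ : 0 < b₂) {doc : ℕ → Finset ℕ}
    (hdoc : (∀ N, doc N = ∅) ∨
      (((fun N => (nUndoc p N (doc N) : ℝ)) =Θ[atTop] fun N : ℕ => (N : ℝ)) ∧
       ((fun N => (nDoc p N (doc N) : ℝ)) =Θ[atTop] fun N : ℕ => (N : ℝ)))) (l : RelConfig)
    {κ G : ℝ} (hκ : 0 < κ) (hG : 0 ≤ G) :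
    ∃ K : ℝ, ∀ᶠ N : ℕ in atTop, ∀ x, GoodSample p T l N x κ G →
      |BMDL p T ν a b₁ b₂ (doc N) l N x - MDL p T l N x - normConst p b₁ b₂ doc N| ≤ K := by
  obtain ⟨K₁, hσ⟩ := exists_abs_log_sigmaSqHat_sub_le p T l hκ hG hν
  obtain ⟨K₂, hdet⟩ := exists_abs_log_det_ridgeGram_sub_le p T l hκ hG hν
  obtain ⟨K₃, hlen⟩ := exists_abs_sum_log_regimeLen_sub_le l
  obtain ⟨K₄, hprior⟩ := (isBigO_prior_sub ha hb₁ hb₂ hdoc l).bound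
  refine ⟨K₁ + |l.m / 2 * Real.log ν| + K₂ + K₃ + K₄ + |Real.log ((l.m : ℝ) + 1)|, ?_⟩
  filter_upwards [hσ, hdet, hlen, hprior] with N hσ hdet hlen hprior x hx
  have hσ := hσ x hx
  have hdet := hdet x hx
  rw [norm_one, mul_one, Real.norm_eq_abs] at hprior
  unfold BMDL MDL
  unfold logPrior at hprior
  have hν' := abs_le.1 (le_refl |(l.m : ℝ) / 2 * Real.log ν|)
  have hm' := abs_le.1 (le_refl |Real.log ((l.m : ℝ) + 1)|)
  rw [abs_le] at hσ hdet hlen hprior ⊢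
  constructor <;> linarith

/-! ### Moments of independent noise -/

section Noise

variable {Ω : Type*} [MeasurableSpace Ω] {P : Measure Ω}

lemma integral_sum_sq_of_orthogonal {ι : Type*} {Y : ι → Ω → ℝ} {v : ℝ} {s : Finset ι}
    (b : ι → ℝ) (hL : ∀ i ∈ s, MemLp (Y i) 2 P) (hv : ∀ i ∈ s, ∫ ω, Y i ω ^ 2 ∂P = v)
    (hY : ∀ i ∈ s, ∀ j ∈ s, i ≠ j → ∫ ω, Y i ω * Y j ω ∂P = 0) :
    ∫ ω, (∑ i ∈ s, b i * Y i ω) ^ 2 ∂P = v * ∑ i ∈ s, b i ^ 2 := by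
  have hint : ∀ i ∈ s, ∀ j ∈ s, Integrable (fun ω => b i * Y i ω * (b j * Y j ω)) P :=
    fun i hi j hj => ((hL i hi).const_mul (b i)).integrable_mul ((hL j hj).const_mul (b j))
  simp only [sq, Finset.sum_mul_sum]
  rw [integral_finsetSum _ fun i hi => integrable_finsetSum _ (hint i hi), Finset.mul_sum]
  refine Finset.sum_congr rfl fun i hi => ?_
  rw [integral_finsetSum _ (hint i hi), Finset.sum_eq_single_of_mem i hi fun j hj hji => ?_]
  · rw [← sq, mul_comm, ← hv i hi, ← integral_const_mul]
    exact integral_congr_ae <| ae_of_all _ fun ω => by ring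
  · rw [← mul_zero (b i * b j), ← hY i hi j hj hji.symm, ← integral_const_mul]
    exact integral_congr_ae <| ae_of_all _ fun ω => by ring

lemma norm_sq_starProjection_eq {ι : Type*} [Fintype ι] (W : Submodule ℝ (EuclideanSpace ℝ ι))
    (z : EuclideanSpace ℝ ι) :
    ‖W.starProjection z‖ ^ 2
      = ∑ b, (∑ i, (stdOrthonormalBasis ℝ W b : EuclideanSpace ℝ ι) i * z i) ^ 2 := by
  rw [W.starProjection_apply, ← Submodule.coe_norm,
    ← (stdOrthonormalBasis ℝ W).sum_sq_norm_inner_right]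
  refine Finset.sum_congr rfl fun b _ => ?_
  rw [Submodule.inner_orthogonalProjectionOnto_eq_of_mem_left, Real.norm_eq_abs, sq_abs]
  simp only [PiLp.inner_apply, RCLike.inner_apply, conj_trivial, mul_comm]

/-- Independent and identically distributed random variables with mean `0` and second moment
`σ ^ 2`, over an arbitrary index type so that subfamilies can be reindexed. -/
structure IsIIDNoise {ι : Type*} (P : Measure Ω) (σ : ℝ) (Z : ι → Ω → ℝ) : Prop where
  indep : iIndepFun Z P
  ident : ∀ s t, IdentDistrib (Z s) (Z t) P P
  memLp : ∀ t, MemLp (Z t) 2 P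
  integral_eq_zero : ∀ t, ∫ ω, Z t ω ∂P = 0
  integral_sq : ∀ t, ∫ ω, Z t ω ^ 2 ∂P = σ ^ 2

lemma IsCausalAR.isIIDNoise {p : ℕ} {φ : Fin p → ℝ} {σ : ℝ} {Z ε : ℤ → Ω → ℝ}
    (h : IsCausalAR P φ σ Z ε) : IsIIDNoise P σ Z where
  indep := h.indep
  ident s t := (h.ident s).trans (h.ident t).symm
  memLp t := (h.ident t).memLp_iff.2 h.memLp
  integral_eq_zero t := by rw [(h.ident t).integral_eq, h.mean_zero]
  integral_sq t := by
    rw [← h.variance_eq, ← (h.ident t).variance_eq, variance_of_integral_eq_zero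
      (h.ident t).aemeasurable_fst (by rw [(h.ident t).integral_eq, h.mean_zero])]

namespace IsIIDNoise

variable {ι : Type*} {σ : ℝ} {Z : ι → Ω → ℝ}

lemma comp (h : IsIIDNoise P σ Z) {κ : Type*} {τ : κ → ι} (hτ : Function.Injective τ) :
    IsIIDNoise P σ fun k => Z (τ k) where
  indep := h.indep.precomp hτ
  ident s t := h.ident (τ s) (τ t)
  memLp t := h.memLp (τ t)
  integral_eq_zero t := h.integral_eq_zero (τ t)
  integral_sq t := h.integral_sq (τ t)

lemma indepFun_sq (h : IsIIDNoise P σ Z) {s t : ι} (hst : s ≠ t) :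
    IndepFun (fun ω => Z s ω ^ 2) (fun ω => Z t ω ^ 2) P :=
  (h.indep.indepFun hst).comp (measurable_id.pow_const 2) (measurable_id.pow_const 2)

lemma integral_mul (h : IsIIDNoise P σ Z) {s t : ι} (hst : s ≠ t) :
    ∫ ω, Z s ω * Z t ω ∂P = 0 := by
  rw [(h.indep.indepFun hst).integral_fun_mul_eq_mul_integral (h.memLp s).1 (h.memLp t).1,
    h.integral_eq_zero, zero_mul]

lemma memLp_mul (h : IsIIDNoise P σ Z) {s t : ι} (hst : s ≠ t) :
    MemLp (fun ω => Z s ω * Z t ω) 2 P := by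
  refine (memLp_two_iff_integrable_sq ((h.memLp s).1.mul (h.memLp t).1)).2 ?_
  refine ((h.indepFun_sq hst).integrable_mul (h.memLp s).integrable_sq
    (h.memLp t).integrable_sq).congr <| ae_of_all _ fun ω => ?_
  simp only [Pi.mul_apply, mul_pow]

lemma integral_mul_sq (h : IsIIDNoise P σ Z) {s t : ι} (hst : s ≠ t) :
    ∫ ω, (Z s ω * Z t ω) ^ 2 ∂P = σ ^ 4 := by
  simp only [mul_pow]
  rw [(h.indepFun_sq hst).integral_fun_mul_eq_mul_integral (h.memLp s).integrable_sq.1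
    (h.memLp t).integrable_sq.1, h.integral_sq, h.integral_sq]
  ring

lemma integral_mul_mul (h : IsIIDNoise P σ Z) {t u v w : ι} (hu : t ≠ u) (hv : t ≠ v)
    (hw : t ≠ w) : ∫ ω, (Z u ω * Z t ω) * (Z v ω * Z w ω) ∂P = 0 := by
  classical
  have hind := h.indep.indepFun_finset₀ {t} {u, v, w} (by simp [hu, hv, hw])
    fun i => (h.memLp i).1.aemeasurable
  have hsingle : Measurable fun f : (({t} : Finset ι) → ℝ) => f ⟨t, by simp⟩ :=
    measurable_pi_apply _
  have htriple : Measurable fun f : (({u, v, w} : Finset ι) → ℝ) =>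
      f ⟨u, by simp⟩ * (f ⟨v, by simp⟩ * f ⟨w, by simp⟩) := by fun_prop
  simp only [mul_comm (Z u _) (Z t _), mul_assoc]
  have hprod := (hind.comp hsingle htriple).integral_fun_mul_eq_mul_integral (h.memLp t).1
    ((h.memLp u).1.mul ((h.memLp v).1.mul (h.memLp w).1))
  simpa only [Function.comp_def, h.integral_eq_zero, zero_mul] using hprod

lemma integral_sum_mul_sq (h : IsIIDNoise P σ Z) (s : Finset ι) (b : ι → ℝ) :
    ∫ ω, (∑ i ∈ s, b i * Z i ω) ^ 2 ∂P = σ ^ 2 * ∑ i ∈ s, b i ^ 2 :=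
  integral_sum_sq_of_orthogonal b (fun i _ => h.memLp i) (fun i _ => h.integral_sq i)
    fun _ _ _ _ => h.integral_mul

lemma memLp_sum_mul (h : IsIIDNoise P σ Z) (s : Finset ι) (b : ι → ℝ) :
    MemLp (fun ω => ∑ i ∈ s, b i * Z i ω) 2 P :=
  memLp_finsetSum _ fun i _ => (h.memLp i).const_mul (b i)

-- For `k ≠ l` the larger of `w k` and `w l` occurs only once among `u k, w k, u l, w l`.
lemma integral_sum_lag_mul_sq [LinearOrder ι] (h : IsIIDNoise P σ Z) {κ : Type*} (s : Finset κ)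
    {u w : κ → ι} (huw : ∀ k, u k < w k) (hw : Function.Injective w) :
    ∫ ω, (∑ k ∈ s, Z (u k) ω * Z (w k) ω) ^ 2 ∂P = σ ^ 4 * s.card := by
  have hsum := integral_sum_sq_of_orthogonal (s := s) (1 : κ → ℝ)
    (fun k _ => h.memLp_mul (huw k).ne) (fun k _ => h.integral_mul_sq (huw k).ne)
    fun k _ l _ hkl => ?_
  · simpa using hsum
  rcases (hw.ne hkl).lt_or_gt with hlt | hlt
  · simp only [mul_comm (Z (u k) _ * Z (w k) _)]
    exact h.integral_mul_mul (huw l).ne' ((huw k).trans hlt).ne' hlt.ne'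
  · exact h.integral_mul_mul (huw k).ne' ((huw l).trans hlt).ne' hlt.ne'

lemma memLp_sum_lag_mul [LinearOrder ι] (h : IsIIDNoise P σ Z) {κ : Type*} (s : Finset κ)
    {u w : κ → ι} (huw : ∀ k, u k < w k) :
    MemLp (fun ω => ∑ k ∈ s, Z (u k) ω * Z (w k) ω) 2 P :=
  memLp_finsetSum _ fun k _ => h.memLp_mul (huw k).ne

lemma integrable_norm_sq_starProjection [Fintype ι] (h : IsIIDNoise P σ Z)
    (W : Submodule ℝ (EuclideanSpace ℝ ι)) :
    Integrable (fun ω => ‖W.starProjection (WithLp.toLp 2 fun i => Z i ω)‖ ^ 2) P := by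
  simp only [norm_sq_starProjection_eq]
  exact integrable_finsetSum _ fun b _ => (h.memLp_sum_mul _ _).integrable_sq

lemma integral_norm_sq_starProjection [Fintype ι] (h : IsIIDNoise P σ Z)
    (W : Submodule ℝ (EuclideanSpace ℝ ι)) :
    ∫ ω, ‖W.starProjection (WithLp.toLp 2 fun i => Z i ω)‖ ^ 2 ∂P
      = σ ^ 2 * Module.finrank ℝ W := by
  have hunit : ∀ b, ∑ i, (stdOrthonormalBasis ℝ W b : EuclideanSpace ℝ ι) i ^ 2 = 1 := fun b => by
    rw [← EuclideanSpace.real_norm_sq_eq, ← Submodule.coe_norm,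
      (stdOrthonormalBasis ℝ W).norm_eq_one, one_pow]
  simp only [norm_sq_starProjection_eq]
  rw [integral_finsetSum _ fun b _ => (h.memLp_sum_mul _ _).integrable_sq]
  simp only [h.integral_sum_mul_sq, hunit, mul_one, Finset.sum_const, Finset.card_univ,
    Fintype.card_fin, nsmul_eq_mul]
  ring

end IsIIDNoise

end Noise

/-! ### Nearly orthogonal families -/

/-- The vectors `z 0, …, z p` are orthogonal with squared norm `v`, and orthogonal to `W`, up to an
error `η` in each inner product and in each squared length of a projection. -/
structure NearlyOrthogonal {E : Type*} [NormedAddCommGroup E] [InnerProductSpace ℝ E] (p : ℕ)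
    (W : Submodule ℝ E) [W.HasOrthogonalProjection] (v η : ℝ) (z : ℕ → E) : Prop where
  abs_inner_sub_le : ∀ i ≤ p, ∀ j ≤ p, |inner ℝ (z i) (z j) - if i = j then v else 0| ≤ η
  norm_sq_starProjection_le : ∀ i ≤ p, ‖W.starProjection (z i)‖ ^ 2 ≤ η

section NearlyOrthogonal

variable {E : Type*} [NormedAddCommGroup E] [InnerProductSpace ℝ E]

lemma norm_sub_starProjection_le_norm_add (W : Submodule ℝ E) [W.HasOrthogonalProjection] (y : E)
    {w : E} (hw : w ∈ W) : ‖y - W.starProjection y‖ ≤ ‖y + w‖ := by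
  have hproj : Wᗮ.starProjection (y + w) = y - W.starProjection y := by
    rw [Submodule.starProjection_orthogonal_val, map_add, W.starProjection_eq_self_iff.2 hw]
    abel
  rw [← hproj]
  exact Submodule.norm_starProjection_apply_le _ _

namespace NearlyOrthogonal

variable {p : ℕ} {W : Submodule ℝ E} [W.HasOrthogonalProjection] {v η : ℝ} {z : ℕ → E}

lemma le_norm_sq_sum (h : NearlyOrthogonal p W v η z) (a : ℕ → ℝ) :
    (v - η * (p + 1)) * ∑ i ∈ Finset.range (p + 1), a i ^ 2
      ≤ ‖∑ i ∈ Finset.range (p + 1), a i • z i‖ ^ 2 := by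
  have hη : 0 ≤ η := (sq_nonneg _).trans (h.norm_sq_starProjection_le 0 (Nat.zero_le p))
  have habs : (∑ i ∈ Finset.range (p + 1), |a i|) ^ 2
      ≤ (p + 1) * ∑ i ∈ Finset.range (p + 1), a i ^ 2 := by
    simpa using sq_sum_le_card_mul_sum_sq (s := Finset.range (p + 1)) (f := fun i => |a i|)
  have hterm : ∀ i ∈ Finset.range (p + 1), ∀ j ∈ Finset.range (p + 1),
      a i * a j * (if i = j then v else 0) - η * (|a i| * |a j|)
        ≤ a i * a j * inner ℝ (z i) (z j) := fun i hi j hj => by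
    have hij := h.abs_inner_sub_le i (Finset.mem_range_succ_iff.1 hi) j
      (Finset.mem_range_succ_iff.1 hj)
    have hprod : |a i * a j * (inner ℝ (z i) (z j) - if i = j then v else 0)|
        ≤ |a i| * |a j| * η := by
      rw [abs_mul, abs_mul]
      gcongr
    linarith [(abs_le.1 hprod).1]
  calc (v - η * (p + 1)) * ∑ i ∈ Finset.range (p + 1), a i ^ 2
      ≤ v * ∑ i ∈ Finset.range (p + 1), a i ^ 2 - η * (∑ i ∈ Finset.range (p + 1), |a i|) ^ 2 := by
        linarith [mul_le_mul_of_nonneg_left habs hη]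
    _ = ∑ i ∈ Finset.range (p + 1), ∑ j ∈ Finset.range (p + 1),
          (a i * a j * (if i = j then v else 0) - η * (|a i| * |a j|)) := by
        simp only [Finset.sum_sub_distrib]
        congr 1
        · rw [Finset.mul_sum]
          refine Finset.sum_congr rfl fun i hi => ?_
          simp only [mul_ite, mul_zero, Finset.sum_ite_eq, hi, if_true]
          ring
        · rw [sq, Finset.sum_mul_sum]
          simp only [Finset.mul_sum]
    _ ≤ ∑ i ∈ Finset.range (p + 1), ∑ j ∈ Finset.range (p + 1), a i * a j * inner ℝ (z i) (z j) :=
        Finset.sum_le_sum fun i hi => Finset.sum_le_sum (hterm i hi)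
    _ = ‖∑ i ∈ Finset.range (p + 1), a i • z i‖ ^ 2 := by
        simp only [← real_inner_self_eq_norm_sq, sum_inner, inner_sum, real_inner_smul_left,
          real_inner_smul_right, mul_assoc]
        exact Finset.sum_congr rfl fun i _ => Finset.sum_congr rfl fun j _ => by
          rw [real_inner_comm]

lemma norm_sq_starProjection_sum_le (h : NearlyOrthogonal p W v η z) (a : ℕ → ℝ) :
    ‖W.starProjection (∑ i ∈ Finset.range (p + 1), a i • z i)‖ ^ 2
      ≤ η * (p + 1) * ∑ i ∈ Finset.range (p + 1), a i ^ 2 := by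
  have hnorm : ‖W.starProjection (∑ i ∈ Finset.range (p + 1), a i • z i)‖
      ≤ ∑ i ∈ Finset.range (p + 1), |a i| * ‖W.starProjection (z i)‖ := by
    rw [map_sum]
    refine norm_sum_le_of_le _ fun i _ => ?_
    rw [map_smul, norm_smul, Real.norm_eq_abs]
  calc _ ≤ (∑ i ∈ Finset.range (p + 1), |a i| * ‖W.starProjection (z i)‖) ^ 2 := by gcongr
    _ ≤ (∑ i ∈ Finset.range (p + 1), |a i| ^ 2) *
          ∑ i ∈ Finset.range (p + 1), ‖W.starProjection (z i)‖ ^ 2 :=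
        Finset.sum_mul_sq_le_sq_mul_sq _ _ _
    _ ≤ (∑ i ∈ Finset.range (p + 1), |a i| ^ 2) * ∑ _i ∈ Finset.range (p + 1), η := by
        gcongr with i hi
        exact h.norm_sq_starProjection_le i (Finset.mem_range_succ_iff.1 hi)
    _ = _ := by
        simp only [sq_abs, Finset.sum_const, Finset.card_range, nsmul_eq_mul, Nat.cast_add_one]
        ring

theorem le_norm_sq_sum_add (h : NearlyOrthogonal p W v η z) (a : ℕ → ℝ) {w : E} (hw : w ∈ W) :
    (v - 2 * η * (p + 1)) * ∑ i ∈ Finset.range (p + 1), a i ^ 2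
      ≤ ‖∑ i ∈ Finset.range (p + 1), a i • z i + w‖ ^ 2 := by
  set y := ∑ i ∈ Finset.range (p + 1), a i • z i
  have hpyth : ‖y‖ ^ 2 = ‖W.starProjection y‖ ^ 2 + ‖y - W.starProjection y‖ ^ 2 := by
    rw [Submodule.norm_sq_eq_add_norm_sq_starProjection y W,
      Submodule.starProjection_orthogonal_val]
  have hdist : ‖y - W.starProjection y‖ ^ 2 ≤ ‖y + w‖ ^ 2 := by
    gcongr
    exact norm_sub_starProjection_le_norm_add W y hw
  linarith [h.le_norm_sq_sum a, h.norm_sq_starProjection_sum_le a]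

end NearlyOrthogonal

end NearlyOrthogonal

/-! ### Asymptotic orthogonality of lagged noise -/

section LaggedNoise

lemma measure_le_ofReal_div {Ω : Type*} [MeasurableSpace Ω] {P : Measure Ω} [IsFiniteMeasure P]
    {f : Ω → ℝ} {c C : ℝ} (hf : ∀ ω, 0 ≤ f ω) (hint : Integrable f P) (hc : 0 < c)
    (hC : ∫ ω, f ω ∂P ≤ C) : P {ω | c ≤ f ω} ≤ ENNReal.ofReal (C / c) := by
  rw [← ofReal_measureReal (measure_ne_top P _)]
  refine ENNReal.ofReal_le_ofReal ((le_div_iff₀' hc).2 ?_)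
  exact (mul_meas_ge_le_integral_of_nonneg (ae_of_all P hf) hint c).trans hC

lemma tendsto_measure_le_of_integral_le {Ω : Type*} [MeasurableSpace Ω] {P : Measure Ω}
    [IsFiniteMeasure P] {f : ℕ → Ω → ℝ} {c : ℕ → ℝ} {C : ℝ} (hf : ∀ n ω, 0 ≤ f n ω)
    (hint : ∀ n, Integrable (f n) P) (hc : Tendsto c atTop atTop)
    (hC : ∀ n, ∫ ω, f n ω ∂P ≤ C) :
    Tendsto (fun n => P {ω | c n ≤ f n ω}) atTop (nhds 0) := by
  have hlim := ENNReal.tendsto_ofReal (hc.const_div_atTop C)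
  rw [ENNReal.ofReal_zero] at hlim
  refine tendsto_of_tendsto_of_tendsto_of_le_of_le' tendsto_const_nhds hlim
    (Eventually.of_forall fun _ => zero_le) ?_
  filter_upwards [hc.eventually_gt_atTop 0] with n hn
  exact measure_le_ofReal_div (hf n) (hint n) hn (hC n)

lemma tendsto_measure_of_ae_imp {Ω : Type*} [MeasurableSpace Ω] {P : Measure Ω}
    {A B : ℕ → Set Ω} (hB : Tendsto (fun n => P (B n)) atTop (nhds 0))
    (hAB : ∀ᶠ n in atTop, ∀ᵐ ω ∂P, ω ∈ A n → ω ∈ B n) :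
    Tendsto (fun n => P (A n)) atTop (nhds 0) :=
  tendsto_of_tendsto_of_tendsto_of_le_of_le' tendsto_const_nhds hB
    (Eventually.of_forall fun _ => zero_le) (hAB.mono fun _ => measure_mono_ae)

lemma tendsto_measure_biUnion {Ω : Type*} [MeasurableSpace Ω] {P : Measure Ω} {ι : Type*}
    (s : Finset ι) {A : ι → ℕ → Set Ω}
    (hA : ∀ i ∈ s, Tendsto (fun n => P (A i n)) atTop (nhds 0)) :
    Tendsto (fun n => P (⋃ i ∈ s, A i n)) atTop (nhds 0) := by
  have hsum := tendsto_finsetSum s hA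
  rw [Finset.sum_const_zero] at hsum
  exact tendsto_of_tendsto_of_tendsto_of_le_of_le tendsto_const_nhds hsum (fun _ => zero_le)
    fun n => measure_biUnion_finset_le s fun i => A i n

lemma norm_sq_lagVec_eq_sum_range (q n i : ℕ) (e : ℕ → ℝ) :
    ‖lagVec q n i e‖ ^ 2 = ∑ k ∈ Finset.range n, e (k + (q + 1) - i) ^ 2 := by
  simp [EuclideanSpace.real_norm_sq_eq, lagVec, Finset.sum_range]

lemma injective_lag {q i : ℕ} (hi : i ≤ q) : Function.Injective fun k : ℕ => k + (q + 1) - i :=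
  fun k k' hk => by simp only at hk; omega

namespace IsIIDNoise

variable {Ω : Type*} [MeasurableSpace Ω] {P : Measure Ω} {σ : ℝ} {Z : ℕ → Ω → ℝ}

lemma tendsto_sum_sq_div (h : IsIIDNoise P σ Z) :
    ∀ᵐ ω ∂P, Tendsto (fun n : ℕ => (∑ k ∈ Finset.range n, Z k ω ^ 2) / n) atTop
      (nhds (σ ^ 2)) := by
  have hlaw := strong_law_ae_real (fun k ω => Z k ω ^ 2) (h.memLp 0).integrable_sq
    (fun _ _ => h.indepFun_sq) fun k => (h.ident k 0).comp (measurable_id.pow_const 2)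
  simpa only [h.integral_sq] using hlaw

variable {q i j : ℕ} {η : ℝ}

variable [IsProbabilityMeasure P]

lemma tendsto_measure_norm_sq_lagVec (h : IsIIDNoise P σ Z) (hi : i ≤ q) (hη : 0 < η) :
    Tendsto (fun n : ℕ => P {ω | η * n ≤ |‖lagVec q n i fun t => Z t ω‖ ^ 2 - σ ^ 2 * n|})
      atTop (nhds 0) := by
  have hmeas : ∀ n : ℕ, AEStronglyMeasurable
      (fun ω => (∑ k ∈ Finset.range n, Z (k + (q + 1) - i) ω ^ 2) / n) P := fun n =>
    ((integrable_finsetSum _ fun k _ => (h.memLp _).integrable_sq).div_const _).1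
  refine tendsto_measure_of_ae_imp (tendstoInMeasure_iff_norm.1 (tendstoInMeasure_of_tendsto_ae
    hmeas (h.comp (injective_lag hi)).tendsto_sum_sq_div) η hη) ?_
  filter_upwards [eventually_gt_atTop 0] with n hn
  refine ae_of_all _ fun ω hω => ?_
  have hn₀ : (0 : ℝ) < n := by exact_mod_cast hn
  rw [norm_sq_lagVec_eq_sum_range] at hω
  rwa [Real.norm_eq_abs, div_sub' hn₀.ne', mul_comm (n : ℝ), abs_div,
    abs_of_pos hn₀, le_div_iff₀ hn₀]

lemma tendsto_measure_inner_lagVec_of_lt (h : IsIIDNoise P σ Z) (hij : i < j) (hi : i ≤ q)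
    (hη : 0 < η) :
    Tendsto (fun n : ℕ => P {ω | η * n ≤
      |inner ℝ (lagVec q n i fun t => Z t ω) (lagVec q n j fun t => Z t ω)|}) atTop (nhds 0) := by
  have hinner : ∀ (n : ℕ) ω, inner ℝ (lagVec q n i fun t => Z t ω) (lagVec q n j fun t => Z t ω)
      = ∑ k ∈ Finset.range n, Z (k + (q + 1) - j) ω * Z (k + (q + 1) - i) ω := fun n ω => by
    simp [lagVec, PiLp.inner_apply, Finset.sum_range]
  have huw : ∀ k, k + (q + 1) - j < k + (q + 1) - i := fun k => by omega
  have hlim := tendsto_measure_le_of_integral_le (P := P) (C := σ ^ 4)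
    (f := fun n ω => (∑ k ∈ Finset.range n, Z (k + (q + 1) - j) ω * Z (k + (q + 1) - i) ω) ^ 2 / n)
    (fun _ _ => by positivity)
    (fun n => (h.memLp_sum_lag_mul _ huw).integrable_sq.div_const _)
    (tendsto_natCast_atTop_atTop.const_mul_atTop (pow_pos hη 2))
    fun n => by
      rw [integral_div, h.integral_sum_lag_mul_sq _ huw (injective_lag hi), Finset.card_range]
      exact div_le_of_le_mul₀ (Nat.cast_nonneg n) (by positivity) le_rfl
  refine tendsto_measure_of_ae_imp hlim ?_
  filter_upwards [eventually_gt_atTop 0] with n hn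
  refine ae_of_all _ fun ω hω => ?_
  have hn₀ : (0 : ℝ) < n := by exact_mod_cast hn
  rw [hinner] at hω
  rw [le_div_iff₀ hn₀, mul_assoc, ← sq, ← mul_pow, ← sq_abs (Finset.sum _ _)]
  gcongr

lemma tendsto_measure_inner_lagVec (h : IsIIDNoise P σ Z) (hi : i ≤ q) (hj : j ≤ q)
    (hη : 0 < η) :
    Tendsto (fun n : ℕ => P {ω | η * n ≤
      |inner ℝ (lagVec q n i fun t => Z t ω) (lagVec q n j fun t => Z t ω)
        - if i = j then σ ^ 2 * n else 0|}) atTop (nhds 0) := by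
  rcases lt_trichotomy i j with hij | rfl | hij
  · simpa only [hij.ne, if_false, sub_zero] using
      h.tendsto_measure_inner_lagVec_of_lt hij hi hη
  · simpa only [if_true, real_inner_self_eq_norm_sq] using
      h.tendsto_measure_norm_sq_lagVec hi hη
  · simpa only [hij.ne', if_false, sub_zero, real_inner_comm (lagVec q _ j _)] using
      h.tendsto_measure_inner_lagVec_of_lt hij hj hη

lemma tendsto_measure_starProjection_lagVec (h : IsIIDNoise P σ Z) (hi : i ≤ q) (hη : 0 < η)
    (W : ∀ n : ℕ, Submodule ℝ (EuclideanSpace ℝ (Fin n))) {K : ℕ}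
    (hW : ∀ n, Module.finrank ℝ (W n) ≤ K) :
    Tendsto (fun n : ℕ => P {ω | η * n ≤
      ‖(W n).starProjection (lagVec q n i fun t => Z t ω)‖ ^ 2}) atTop (nhds 0) := by
  have hcomp : ∀ n : ℕ, IsIIDNoise P σ fun k : Fin n => Z (k + (q + 1) - i) := fun n =>
    h.comp ((injective_lag hi).comp Fin.val_injective)
  refine tendsto_measure_le_of_integral_le (C := σ ^ 2 * K) (fun _ _ => sq_nonneg _)
    (fun n => (hcomp n).integrable_norm_sq_starProjection (W n))
    (tendsto_natCast_atTop_atTop.const_mul_atTop hη) fun n => ?_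
  refine ((hcomp n).integral_norm_sq_starProjection (W n)).le.trans ?_
  gcongr
  exact hW n

theorem tendsto_measure_not_nearlyOrthogonal (h : IsIIDNoise P σ Z) {p : ℕ} (hp : p ≤ q)
    (hη : 0 < η) (W : ∀ n : ℕ, Submodule ℝ (EuclideanSpace ℝ (Fin n))) {K : ℕ}
    (hW : ∀ n, Module.finrank ℝ (W n) ≤ K) :
    Tendsto (fun n : ℕ => P {ω | ¬NearlyOrthogonal p (W n) (σ ^ 2 * n) (η * n)
      fun i => lagVec q n i fun t => Z t ω}) atTop (nhds 0) := by
  have hle : ∀ i ∈ Finset.range (p + 1), i ≤ q := fun i hi =>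
    (Finset.mem_range_succ_iff.1 hi).trans hp
  have hgram := tendsto_measure_biUnion (Finset.range (p + 1)) fun i hi =>
    tendsto_measure_biUnion (Finset.range (p + 1)) fun j hj =>
      h.tendsto_measure_inner_lagVec (hle i hi) (hle j hj) hη
  have hproj := tendsto_measure_biUnion (Finset.range (p + 1)) fun i hi =>
    h.tendsto_measure_starProjection_lagVec (hle i hi) hη W hW
  have hsum := hgram.add hproj
  rw [add_zero] at hsum
  refine tendsto_of_tendsto_of_tendsto_of_le_of_le tendsto_const_nhds hsum (fun _ => zero_le)
    fun n => (measure_mono fun ω hω => ?_).trans (measure_union_le _ _)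
  by_contra hnot
  simp only [Set.mem_union, Set.mem_iUnion, Set.mem_ofPred_eq, Finset.mem_range_succ_iff, not_or,
    not_exists, not_le] at hnot
  exact hω ⟨fun i hi j hj => (hnot.1 i hi j hj).le, fun i hi => (hnot.2 i hi).le⟩

end IsIIDNoise

end LaggedNoise

/-! ### Lag combinations of autoregressive data -/

section LagSpan

/-- The span of the sequences `col c` delayed by at most `q`, observed at the times
`q + 1, …, q + n`. It contains every lag combination of order at most `q` of the `col c`. -/
def lagSpan (q n : ℕ) {ι : Type*} (col : ι → ℕ → ℝ) : Submodule ℝ (EuclideanSpace ℝ (Fin n)) :=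
  Submodule.span ℝ (Set.range fun c : Fin (q + 1) × ι => lagVec q n c.1 (col c.2))

variable {ι : Type*} [Fintype ι]

lemma finrank_lagSpan_le (q n : ℕ) (col : ι → ℕ → ℝ) :
    Module.finrank ℝ (lagSpan q n col) ≤ (q + 1) * Fintype.card ι := by
  refine (finrank_range_le_card _).trans_eq ?_
  rw [Fintype.card_prod, Fintype.card_fin]

lemma lagVec_sum_mem_lagSpan {q i : ℕ} (hi : i ≤ q) (n : ℕ) (col : ι → ℕ → ℝ) (w : ι → ℝ) :
    lagVec q n i (fun t => ∑ c, w c * col c t) ∈ lagSpan q n col := by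
  rw [lagVec_sum_smul]
  exact Submodule.sum_mem _ fun c _ => Submodule.smul_mem _ _ <|
    Submodule.subset_span ⟨(⟨i, Nat.lt_succ_of_le hi⟩, c), rfl⟩

lemma lagSum_comm (p q : ℕ) (a b f : ℕ → ℝ) :
    lagSum p a (lagSum q b f) = lagSum q b (lagSum p a f) := by
  ext t
  simp only [lagSum, Finset.mul_sum, Nat.sub_sub]
  rw [Finset.sum_comm]
  refine Finset.sum_congr rfl fun j _ => Finset.sum_congr rfl fun i _ => ?_
  rw [add_comm i j]
  ring

lemma exists_lagVec_lagSum_add_eq {p : ℕ} {b e ζ : ℕ → ℝ} (hζ : ∀ t, p ≤ t → lagSum p b e t = ζ t)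
    (n : ℕ) (a : ℕ → ℝ) (col : ι → ℕ → ℝ) (w : ι → ℝ) :
    ∃ y ∈ lagSpan (p + p) n col,
      lagVec (p + p) n 0 (lagSum p b (lagSum p a fun t => e t + ∑ c, w c * col c t))
        = ∑ i ∈ Finset.range (p + 1), a i • lagVec (p + p) n i ζ + y := by
  refine ⟨∑ i ∈ Finset.range (p + 1), a i • ∑ j ∈ Finset.range (p + 1),
    b j • lagVec (p + p) n (i + j) (fun t => ∑ c, w c * col c t), ?_, ?_⟩
  · refine Submodule.sum_mem _ fun i hi => Submodule.smul_mem _ _ <|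
      Submodule.sum_mem _ fun j hj => Submodule.smul_mem _ _ <| lagVec_sum_mem_lagSpan ?_ n col w
    exact add_le_add (Finset.mem_range_succ_iff.1 hi) (Finset.mem_range_succ_iff.1 hj)
  · have hnoise : ∀ i ∈ Finset.range (p + 1), lagVec (p + p) n i ζ
        = ∑ j ∈ Finset.range (p + 1), b j • lagVec (p + p) n (i + j) e := fun i hi => by
      rw [← lagVec_lagSum]
      ext k
      exact (hζ _ (by have := Finset.mem_range_succ_iff.1 hi; omega)).symm
    rw [lagSum_comm, lagVec_lagSum, ← Finset.sum_add_distrib]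
    refine Finset.sum_congr rfl fun i hi => ?_
    rw [zero_add, lagVec_lagSum, hnoise i hi, ← smul_add, ← Finset.sum_add_distrib]
    simp only [lagVec_add, smul_add]

-- The filter with coefficients `b` turns the lag combination of the data into the same combination
-- of `ζ`, up to an element of the lag span, and increases norms by at most a constant factor.
theorem NearlyOrthogonal.le_sum_lagSum_sq {p n : ℕ} {col : ι → ℕ → ℝ} {v η : ℝ} {b e ζ : ℕ → ℝ}
    (h : NearlyOrthogonal p (lagSpan (p + p) n col) v η fun i => lagVec (p + p) n i ζ)
    (hζ : ∀ t, p ≤ t → lagSum p b e t = ζ t) (a : ℕ → ℝ) (w : ι → ℝ) :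
    (v - 2 * η * (p + 1)) * ∑ i ∈ Finset.range (p + 1), a i ^ 2
      ≤ (∑ i ∈ Finset.range (p + 1), b i ^ 2) * ((p + 1) *
        ∑ t ∈ Finset.Icc (p + 1) (p + p + n),
          lagSum p a (fun t => e t + ∑ c, w c * col c t) t ^ 2) := by
  obtain ⟨y, hy, heq⟩ := exists_lagVec_lagSum_add_eq hζ n a col w
  refine (h.le_norm_sq_sum_add a hy).trans ?_
  rw [← heq, norm_sq_lagVec]
  exact sum_lagSum_sq_le p b _ p (p + p + n)

end LagSpan

section Causal

variable {Ω : Type*} [MeasurableSpace Ω] {P : Measure Ω} {p : ℕ} {φ : Fin p → ℝ} {σ : ℝ}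
  {Z ε : ℤ → Ω → ℝ}

lemma lagSum_arCoeff_eq_of_recursion {e ζ : ℤ → ℝ}
    (hrec : ∀ t : ℤ, e t = ∑ j : Fin p, φ j * e (t - ((j : ℤ) + 1)) + ζ t) {t : ℕ} (ht : p ≤ t) :
    lagSum p (arCoeff φ) (fun t : ℕ => e t) t = ζ t := by
  rw [← arFilter_eq_lagSum, arFilter, hrec t, add_sub_assoc, add_comm, sub_add]
  rw [sub_eq_self, sub_eq_zero]
  refine Finset.sum_congr rfl fun j _ => ?_
  rw [Nat.cast_sub (by omega), Nat.cast_add_one]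

lemma sum_arCoeff_sq_pos (φ : Fin p → ℝ) : 0 < ∑ i ∈ Finset.range (p + 1), arCoeff φ i ^ 2 :=
  Finset.sum_pos' (fun _ _ => sq_nonneg _) ⟨0, by simp [arCoeff]⟩

namespace IsCausalAR

theorem exists_tendsto_measure_not_le_sum_lagSum_sq [IsProbabilityMeasure P]
    (h : IsCausalAR P φ σ Z ε) (hσ : 0 < σ) {ι : Type*} [Fintype ι] (col : ℕ → ι → ℕ → ℝ) :
    ∃ κ > 0, Tendsto (fun N : ℕ => P {ω | ¬∀ (a : ℕ → ℝ) (w : ι → ℝ),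
      κ * N * ∑ i ∈ Finset.range (p + 1), a i ^ 2 ≤ ∑ t ∈ Finset.Icc (p + 1) N,
        lagSum p a (fun t => ε t ω + ∑ c, w c * col N c t) t ^ 2}) atTop (nhds 0) := by
  set C := ∑ i ∈ Finset.range (p + 1), arCoeff φ i ^ 2
  have hC : 0 < C := sum_arCoeff_sq_pos φ
  have hnoise := (h.isIIDNoise.comp Nat.cast_injective).tendsto_measure_not_nearlyOrthogonal
    (Nat.le_add_left p p) (η := σ ^ 2 / (4 * (p + 1))) (by positivity)
    (fun n => lagSpan (p + p) n (col (n + (p + p)))) fun n => finrank_lagSpan_le _ _ _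
  refine ⟨σ ^ 2 / 4 / (C * (p + 1)), by positivity,
    (tendsto_add_atTop_iff_nat (p + p)).1 (tendsto_measure_of_ae_imp hnoise ?_)⟩
  filter_upwards [eventually_ge_atTop (p + p)] with n hn
  filter_upwards [ae_all_iff.2 h.recursion] with ω hrec hbad hgood
  refine hbad fun a w => ?_
  have hn₀ : ((p + p : ℕ) : ℝ) ≤ n := by exact_mod_cast hn
  have hlow := hgood.le_sum_lagSum_sq (fun t => lagSum_arCoeff_eq_of_recursion hrec) a w
  rw [add_comm n (p + p), div_mul_eq_mul_div, div_mul_eq_mul_div, div_le_iff₀ (by positivity)]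
  calc σ ^ 2 / 4 * (p + p + n : ℕ) * ∑ i ∈ Finset.range (p + 1), a i ^ 2
      ≤ (σ ^ 2 * n - 2 * (σ ^ 2 / (4 * (p + 1)) * n) * (p + 1)) *
          ∑ i ∈ Finset.range (p + 1), a i ^ 2 := by
        refine mul_le_mul_of_nonneg_right ?_ (Finset.sum_nonneg fun _ _ => sq_nonneg _)
        push_cast at hn₀ ⊢
        field_simp
        linarith
    _ ≤ _ := hlow
    _ = _ := by rw [add_comm n]; ring

end IsCausalAR

end Causal

/-! ### Probability of good samples -/

section GoodSampleProbability

lemma integrable_and_integral_le_of_tendsto_ae {Ω : Type*} [MeasurableSpace Ω] {P : Measure Ω}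
    {Y : ℕ → Ω → ℝ} {y : Ω → ℝ} {V : ℝ} (hV : 0 ≤ V) (hY : ∀ n, Integrable (Y n) P)
    (hY₀ : ∀ n ω, 0 ≤ Y n ω) (hle : ∀ n, ∫ ω, Y n ω ∂P ≤ V)
    (hlim : ∀ᵐ ω ∂P, Tendsto (fun n => Y n ω) atTop (nhds (y ω))) :
    Integrable y P ∧ ∫ ω, y ω ∂P ≤ V := by
  have hy₀ : 0 ≤ᵐ[P] y := hlim.mono fun ω hω => ge_of_tendsto' hω fun n => hY₀ n ω
  have hfatou : ∫⁻ ω, ENNReal.ofReal (y ω) ∂P ≤ ENNReal.ofReal V :=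
    calc ∫⁻ ω, ENNReal.ofReal (y ω) ∂P
        = ∫⁻ ω, liminf (fun n => ENNReal.ofReal (Y n ω)) atTop ∂P :=
          lintegral_congr_ae <| hlim.mono fun ω hω => (ENNReal.tendsto_ofReal hω).liminf_eq.symm
      _ ≤ liminf (fun n => ∫⁻ ω, ENNReal.ofReal (Y n ω) ∂P) atTop :=
          lintegral_liminf_le' fun n => (hY n).1.aemeasurable.ennreal_ofReal
      _ ≤ ENNReal.ofReal V := by
          refine liminf_le_of_frequently_le' (Frequently.of_forall fun n => ?_)
          rw [← ofReal_integral_eq_lintegral_ofReal (hY n) (ae_of_all _ (hY₀ n))]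
          exact ENNReal.ofReal_le_ofReal (hle n)
  have hint : Integrable y P := by
    refine ⟨aestronglyMeasurable_of_tendsto_ae _ (fun n => (hY n).1) hlim, ?_⟩
    rw [hasFiniteIntegral_iff_ofReal hy₀]
    exact hfatou.trans_lt ENNReal.ofReal_lt_top
  rw [← ofReal_integral_eq_lintegral_ofReal hint hy₀] at hfatou
  exact ⟨hint, (ENNReal.ofReal_le_ofReal_iff hV).1 hfatou⟩

lemma sum_range_sq_le_tsum_abs_sq {ψ : ℕ → ℝ} (hψ : Summable fun j => |ψ j|) (n : ℕ) :
    ∑ j ∈ Finset.range n, ψ j ^ 2 ≤ (∑' j, |ψ j|) ^ 2 :=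
  calc ∑ j ∈ Finset.range n, ψ j ^ 2 = ∑ j ∈ Finset.range n, |ψ j| ^ 2 := by simp only [sq_abs]
    _ ≤ (∑ j ∈ Finset.range n, |ψ j|) ^ 2 :=
        Finset.sum_sq_le_sq_sum_of_nonneg fun _ _ => abs_nonneg _
    _ ≤ (∑' j, |ψ j|) ^ 2 := by
        gcongr
        exact hψ.sum_le_tsum _ fun _ _ => abs_nonneg _

variable {Ω : Type*} [MeasurableSpace Ω] {P : Measure Ω}

lemma exists_measure_sum_add_sq_gt_le [IsFiniteMeasure P] {y : ℕ → Ω → ℝ} {V : ℝ}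
    (hint : ∀ t, Integrable (fun ω => y t ω ^ 2) P) (hV : ∀ t, ∫ ω, y t ω ^ 2 ∂P ≤ V)
    {f : ℕ → ℕ → ℝ} {B : ℝ} (hB : ∀ N, ∑ t ∈ Finset.Icc 1 N, f N t ^ 2 ≤ B * N)
    {δ : ℝ} (hδ : 0 < δ) :
    ∃ G, 0 ≤ G ∧ ∀ N : ℕ, P {ω | G * N < ∑ t ∈ Finset.Icc 1 N, (f N t + y t ω) ^ 2}
      ≤ ENNReal.ofReal δ := by
  have hV₀ : 0 ≤ V := (integral_nonneg fun ω => sq_nonneg (y 0 ω)).trans (hV 0)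
  have hB₀ : 0 ≤ B := (sq_nonneg (f 1 1)).trans (by simpa using hB 1)
  set c := (V + 1) / δ with hc
  have hc₀ : 0 < c := by positivity
  refine ⟨2 * B + 2 * c, by positivity, fun N => ?_⟩
  rcases N.eq_zero_or_pos with rfl | hN
  · simp
  have hN₀ : (0 : ℝ) < N := by exact_mod_cast hN
  have hmean : ∫ ω, ∑ t ∈ Finset.Icc 1 N, y t ω ^ 2 ∂P ≤ V * N := by
    rw [integral_finsetSum _ fun t _ => hint t]
    exact (Finset.sum_le_sum fun t _ => hV t).trans_eq (by simp [mul_comm])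
  have hsub : ∀ ω, (2 * B + 2 * c) * N < ∑ t ∈ Finset.Icc 1 N, (f N t + y t ω) ^ 2 →
      c * N ≤ ∑ t ∈ Finset.Icc 1 N, y t ω ^ 2 := fun ω hω => by
    have hsq : ∑ t ∈ Finset.Icc 1 N, (f N t + y t ω) ^ 2
        ≤ 2 * ∑ t ∈ Finset.Icc 1 N, f N t ^ 2 + 2 * ∑ t ∈ Finset.Icc 1 N, y t ω ^ 2 := by
      rw [Finset.mul_sum, Finset.mul_sum, ← Finset.sum_add_distrib]
      exact Finset.sum_le_sum fun t _ => add_sq_le.trans_eq (mul_add _ _ _)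
    linarith [hB N]
  refine (measure_mono hsub).trans <| (measure_le_ofReal_div
    (fun ω => Finset.sum_nonneg fun _ _ => sq_nonneg _) (integrable_finsetSum _ fun t _ => hint t)
    (by positivity) hmean).trans <| ENNReal.ofReal_le_ofReal ?_
  rw [mul_div_mul_right _ _ hN₀.ne', div_le_iff₀ hc₀, hc, mul_div_cancel₀ _ hδ.ne']
  exact (lt_add_one V).le

namespace IsCausalAR

variable {p : ℕ} {φ : Fin p → ℝ} {σ : ℝ} {Z ε : ℤ → Ω → ℝ}

lemma exists_integral_sq_le (h : IsCausalAR P φ σ Z ε) :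
    ∃ V, ∀ t, Integrable (fun ω => ε t ω ^ 2) P ∧ ∫ ω, ε t ω ^ 2 ∂P ≤ V := by
  obtain ⟨ψ, hψ, hsum⟩ := h.causal
  refine ⟨σ ^ 2 * (∑' j, |ψ j|) ^ 2, fun t => ?_⟩
  have hnoise : IsIIDNoise P σ fun j : ℕ => Z (t - j) :=
    h.isIIDNoise.comp fun j k hjk => by simpa using hjk
  refine integrable_and_integral_le_of_tendsto_ae
    (Y := fun n ω => (∑ j ∈ Finset.range n, ψ j * Z (t - j) ω) ^ 2) (by positivity)
    (fun n => (hnoise.memLp_sum_mul _ ψ).integrable_sq) (fun _ _ => sq_nonneg _) (fun n => ?_)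
    ((hsum t).mono fun ω hω => hω.tendsto_sum_nat.pow 2)
  rw [hnoise.integral_sum_mul_sq]
  gcongr
  exact sum_range_sq_le_tsum_abs_sq hψ n

end IsCausalAR

/-- The sequences spanning the part of the data `f + ε` that is not the error `ε`, once a mean
function of the configuration `l` is removed: `f` itself and the columns of the design. -/
def meanCol (T : ℕ) (l : RelConfig) (N : ℕ) (f : ℕ → ℝ) : Option (Fin T ⊕ Fin l.m) → ℕ → ℝ
  | none => f
  | some (.inl v) => fun t => seasonInd T t v
  | some (.inr r) => fun t => regimeInd l N t r

lemma exists_sum_meanCol_eq {T : ℕ} {l : RelConfig} {N : ℕ} (f : ℕ → ℝ) (s : Fin T → ℝ)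
    (μ : Fin l.m → ℝ) :
    ∃ w : Option (Fin T ⊕ Fin l.m) → ℝ, ∀ t,
      ∑ c, w c * meanCol T l N f c t = f t - fitted T l N s μ t := by
  refine ⟨fun c => c.elim 1 fun c => -Sum.elim s μ c, fun t => ?_⟩
  simp [Fintype.sum_option, meanCol, fitted, mul_comm (seasonInd T t _),
    mul_comm (regimeInd l N t _)]
  ring

theorem IsCausalAR.exists_measure_not_goodSample_le [IsProbabilityMeasure P] {p T : ℕ}
    {φ : Fin p → ℝ} {σ : ℝ} {Z ε : ℤ → Ω → ℝ} (h : IsCausalAR P φ σ Z ε) (hσ : 0 < σ)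
    {f : ℕ → ℕ → ℝ} {B : ℝ} (hB : ∀ N, ∑ t ∈ Finset.Icc 1 N, f N t ^ 2 ≤ B * N) (l : RelConfig)
    {δ : ℝ} (hδ : 0 < δ) :
    ∃ κ G, 0 < κ ∧ 0 ≤ G ∧ ∀ᶠ N in atTop,
      P {ω | ¬GoodSample p T l N (fun t => f N t + ε t ω) κ G} ≤ ENNReal.ofReal δ := by
  obtain ⟨V, hV⟩ := h.exists_integral_sq_le
  obtain ⟨G, hG, hupper⟩ := exists_measure_sum_add_sq_gt_le (y := fun t : ℕ => ε t)
    (fun t => (hV t).1) (fun t => (hV t).2) hB (half_pos hδ)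
  obtain ⟨κ, hκ, hlower⟩ := h.exists_tendsto_measure_not_le_sum_lagSum_sq hσ
    fun N => meanCol T l N (f N)
  refine ⟨κ, G, hκ, hG, ?_⟩
  filter_upwards [hlower.eventually_le_const (ENNReal.ofReal_pos.2 (half_pos hδ))] with N hN
  rw [← add_halves δ, ENNReal.ofReal_add (half_pos hδ).le (half_pos hδ).le]
  refine (measure_mono fun ω hω => ?_).trans <|
    (measure_union_le _ _).trans (add_le_add (hupper N) hN)
  by_contra hnot
  simp only [Set.mem_union, Set.mem_ofPred_eq, not_or, not_not, not_lt] at hnot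
  refine hω ⟨hnot.1, fun a s μ => ?_⟩
  obtain ⟨w, hw⟩ := exists_sum_meanCol_eq (N := N) (f N) s μ
  refine (hnot.2 a w).trans_eq ?_
  simp only [hw]
  congr! 4 with t
  ring

end GoodSampleProbability

lemma abs_fitted_le {T : ℕ} (l : RelConfig) (N : ℕ) (s : Fin T → ℝ) (μ : Fin l.m → ℝ) (t : ℕ) :
    |fitted T l N s μ t| ≤ ∑ v, |s v| + ∑ r, |μ r| := by
  refine (abs_add_le _ _).trans (add_le_add ?_ ?_)
  · refine (Finset.abs_sum_le_sum_abs _ _).trans (Finset.sum_le_sum fun v _ => ?_)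
    unfold seasonInd
    split_ifs <;> simp
  · refine (Finset.abs_sum_le_sum_abs _ _).trans (Finset.sum_le_sum fun r _ => ?_)
    unfold regimeInd
    split_ifs <;> simp

lemma sum_fitted_sq_le {T : ℕ} (l : RelConfig) (N : ℕ) (s : Fin T → ℝ) (μ : Fin l.m → ℝ) :
    ∑ t ∈ Finset.Icc 1 N, fitted T l N s μ t ^ 2 ≤ (∑ v, |s v| + ∑ r, |μ r|) ^ 2 * N := by
  refine (Finset.sum_le_card_nsmul _ _ ((∑ v, |s v| + ∑ r, |μ r|) ^ 2) fun t _ => ?_).trans_eq ?_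
  · rw [← sq_abs]
    gcongr
    exact abs_fitted_le l N s μ t
  · simp [mul_comm]

end Changepoint

end

theorem theorem3_general
    (p T : ℕ) (hT : 1 ≤ T) (ν a b₁ b₂ : ℝ) (hν : 0 < ν) (ha : 0 < a) (hb₁ : 0 < b₁) (hb₂ : 0 < b₂)
    (doc : ℕ → Finset ℕ)
    (hdoc : (∀ N, doc N = ∅) ∨
      (((fun N => (Changepoint.nUndoc p N (doc N) : ℝ)) =Θ[Filter.atTop] fun N : ℕ => (N : ℝ)) ∧
       ((fun N => (Changepoint.nDoc p N (doc N) : ℝ)) =Θ[Filter.atTop] fun N : ℕ => (N : ℝ)))) :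
    ∃ c : ℕ → ℝ,
      ∀ (Ω : Type*) [MeasurableSpace Ω] (P : MeasureTheory.Measure Ω)
        [MeasureTheory.IsProbabilityMeasure P] (f : ℕ → ℕ → ℝ)
        (_ : ∃ B : ℝ, ∀ N : ℕ, ∑ t ∈ Finset.Icc 1 N, f N t ^ 2 ≤ B * N)
        (φ : Fin p → ℝ) (σ : ℝ) (_ : 0 < σ) (Z ε : ℤ → Ω → ℝ)
        (_ : Changepoint.IsCausalAR P φ σ Z ε) (l : Changepoint.RelConfig),
          Changepoint.IsBigOPOne P fun N ω =>
            Changepoint.BMDL p T ν a b₁ b₂ (doc N) l N (fun t => f N t + ε t ω)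
              - Changepoint.MDL p T l N (fun t => f N t + ε t ω) - c N := by
  have : NeZero T := ⟨by omega⟩
  refine ⟨Changepoint.normConst p b₁ b₂ doc, fun Ω _ P _ f ⟨B, hB⟩ φ σ hσ Z ε h l δ hδ => ?_⟩
  obtain ⟨κ, G, hκ, hG, hgood⟩ := h.exists_measure_not_goodSample_le (T := T) hσ hB l hδ
  obtain ⟨K, hK⟩ := Changepoint.exists_abs_BMDL_sub_MDL_sub_normConst_le (T := T)
    hν ha hb₁ hb₂ hdoc l hκ hG
  refine ⟨K, ?_⟩
  filter_upwards [hgood, hK] with N hgood hK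
  exact (measure_mono fun ω hω hx => (hK _ hx).not_gt hω).trans hgood

theorem theorem3
    -- AR order, period, prior hyper-parameters, class of candidate models
    (p T : ℕ) (hT : 1 ≤ T) (ν a b₁ b₂ : ℝ) (hν : 0 < ν) (ha : 0 < a) (hb₁ : 0 < b₁) (hb₂ : 0 < b₂)
    (M : ℕ) (d : ℝ) (hd : 0 < d)
    -- documented times for each sample size: either no metadata at all, or both the documented
    -- and the undocumented times increase linearly
    (doc : ℕ → Finset ℕ)
    (hdoc : (∀ N, doc N = ∅) ∨
      (((fun N => (Changepoint.nUndoc p N (doc N) : ℝ)) =Θ[Filter.atTop] fun N : ℕ => (N : ℝ)) ∧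
       ((fun N => (Changepoint.nDoc p N (doc N) : ℝ)) =Θ[Filter.atTop] fun N : ℕ => (N : ℝ)))) :
    -- the additive constant depends on `N`, not on the candidate model, the truth or the data
    ∃ c : ℕ → ℝ,
      ∀ (Ω : Type*) [MeasurableSpace Ω] (P : MeasureTheory.Measure Ω)
        [MeasureTheory.IsProbabilityMeasure P]
        (l0 : Changepoint.RelConfig) (_ : l0 ∈ Changepoint.Lam M d)
        (s : Fin T → ℝ) (μ : Fin l0.m → ℝ) (φ : Fin p → ℝ) (σ : ℝ) (_ : 0 < σ)
        (Z ε : ℤ → Ω → ℝ) (_ : Changepoint.IsCausalAR P φ σ Z ε),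
        ∀ l ∈ Changepoint.Lam M d,
          Changepoint.IsBigOPOne P fun N ω =>
            Changepoint.BMDL p T ν a b₁ b₂ (doc N) l N (Changepoint.obs l0 s μ ε N ω)
              - Changepoint.MDL p T l N (Changepoint.obs l0 s μ ε N ω) - c N := by
  obtain ⟨c, hc⟩ := theorem3_general p T hT ν a b₁ b₂ hν ha hb₁ hb₂ doc hdoc
  exact ⟨c, fun Ω _ P _ l0 _ s μ φ σ hσ Z ε h l _ =>
    hc Ω P (fun N => Changepoint.fitted T l0 N s μ)
      ⟨_, fun N => Changepoint.sum_fitted_sq_le l0 N s μ⟩ φ σ hσ Z ε h l⟩
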